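/- **Setting.** Let $\mathsf{St}_{d,r}=\{X\in\mathbb R^{d\times r}:X^{\mathsf T}X=I_r\}$ and $f=\frac1n\sum_{i=1}^n f_i$, $n\ge1$, where each $f_i:\mathbb R^{d\times r}\to\mathbb R$ is differentiable at every point of $\mathsf{St}_{d,r}$ and its Euclidean gradient satisfies $\|\nabla f_i(X)-\nabla f_i(Y)\|_{\mathsf F}\le L\|X-Y\|_{\mathsf F}$ for $X,Y\in\mathsf{St}_{d,r}$ ($L>0$). For $\rho\ge0$ put $\mathbf D_\rho(X,Y)=(I_d-XX^{\mathsf T})Y+4\rho X\,\frac{X^{\mathsf T}Y-Y^{\mathsf T}X}{2}$, $\operatorname{grad}f(X)=\mathbf D_\rho(X,\nabla f(X))$, and $\nu=\min\{1,1/(4\rho)\}$ ($\nu=1$ if $\rho=0$). Let $T_X=\{E:X^{\mathsf T}E+E^{\mathsf T}X=0\}$ if $\rho>0$, and $T_X=\{E:X^{\mathsf T}E=0\}$ if $\rho=0$. Let $\mathcal R$ be a retraction: for each $X\in\mathsf{St}_{d,r}$, $\mathcal R(X,\cdot):T_X\to\mathsf{St}_{d,r}$ is smooth, $\mathcal R(X,0)=X$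 and $\frac{d}{dt}\mathcal R(X,tE)|_{t=0}=E$. Let $L_1\ge1$, $L_2>0$, $C>0$ be constants such that for all $X\in\mathsf{St}_{d,r}$, $E\in T_X$, $t\ge0$ $$\|\mathcal R(X,tE)-X\|_{\mathsf F}\le L_1t\|E\|_{\mathsf F},\quad \|\mathcal R(X,tE)-X-tE\|_{\mathsf F}\le L_2t^2\|E\|_{\mathsf F}^2,\quad \|\nabla f(X)\|_{\mathsf F}\le C,$$ and put $\tilde L=L_1^2+4L_2\sqrt r$, $\hat L=2L_2C+L_1^2L$. Let $0<\tau_{\min}<\tau_{\max}$, $0\le\mu\le2/3$, $\kappa>0$ and $$K=\lceil(\kappa n)^{1/(3(1-\mu))}\rceil,\qquad b=\lceil K^{2-3\mu}\rceil,\qquad \beta=\tfrac{\sqrt{\tilde L}L}{\nu}K^{\mu-1}.$$ **Method (S-SVRG-BB).** Start from $X^{0,0}\in\mathsf{St}_{d,r}$. In epoch $s=0,\dots,S-1$ compute $\nabla f(X^{s,0})$ ($n$ IFO calls) and the step size $\tau_s=\tau_s^{\mathrm{LBB}}/K$, where $\tau_0^{\mathrm{LBB}}\in[\tau_{\min},\tau_{\max}]$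 is arbitrary and, for $s\ge1$, $\tau_s^{\mathrm{LBB}}=\max\{\tau_{\min},\min\{\langle\mathsf S,\mathsf S\rangle/|\langle\mathsf S,\mathsf Y\rangle|,\tau_{\max}\}\}$ with $\mathsf S=X^{s,0}-X^{s-1,0}$, $\mathsf Y=\operatorname{grad}f(X^{s,0})-\operatorname{grad}f(X^{s-1,0})$ (the quotient counts as $+\infty$ if $\langle\mathsf S,\mathsf Y\rangle=0$). For $k=0,\dots,K-1$ draw $i_1,\dots,i_b$ independently and uniformly from $\{1,\dots,n\}$, independently of all earlier draws, and set $$\mathcal G=\nabla f(X^{s,0})+\tfrac1b\sum_{j=1}^b\big(\nabla f_{i_j}(X^{s,k})-\nabla f_{i_j}(X^{s,0})\big),\qquad X^{s,k+1}=\mathcal R\big(X^{s,k},-\tau_s\mathbf D_\rho(X^{s,k},\mathcal G)\big)$$ ($2b$ IFO calls, one retraction call). Put $X^{s+1,0}=X^{s,K}$; let $X^s_{\mathrm{out}}=X^{s,k}$ with probability $p_{s,k}$, and return $X_{\mathrm{out}}$ chosen uniformly among $X^0_{\mathrm{out}},\dots,X^{S-1}_{\mathrm{out}}$. Here $p_{s,K}=0$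 and $p_{s,k}=\Delta_{s,k}/\sum_{j<K}\Delta_{s,j}$ for $k<K$, with $\Gamma(z,i)=\frac{(1+z)^{i-1}-1}{z}$ and $$\frac{\Delta_{s,k}}{\tau_s}=\nu-\frac{\hat L\tau_s}2\Big[1+\Big(1+\frac2{\tilde L\beta\tau_s}\Big)\frac{\tilde LL^2\tau_s^2}{\nu^2b}\,\Gamma\Big(2\beta\tau_s+\frac{\tilde LL^2\tau_s^2}{\nu^2b},K-k\Big)\Big].$$ **Choice of $\kappa$.** Call $c$ an *induced constant* if $c=\varrho K^{\mu-1}$ for some $\varrho$ with $\varrho\nu/(\sqrt{\tilde L}L)\in[\tau_{\min},\tau_{\max}]$; so $\tau_s=\frac{c\nu}{\sqrt{\tilde L}L}K^{-\mu}$ for one of these $c$. Call $\kappa>0$ *admissible* for $n$ if every induced constant $c$ lies in $(0,1)$ and satisfies $\frac{\hat L}{\sqrt{\tilde L}L}\exp(c^2+2c)\,c\le1$. **Claim.** Let $D\in\mathbb R$. 1. There are a nondecreasing $A$ and a nonincreasing $B$ on $(0,\infty)$, depending only on $r,\rho,L,L_1,L_2,C,\mu,\tau_{\min},\tau_{\max},D$,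 such that for all $d$, $n\ge1$, all $f_i$, $\mathcal R$, $X^{0,0}$, $\tau_0^{\mathrm{LBB}}$ as above with $f(X^{0,0})-\min_{\mathsf{St}_{d,r}}f\le D$, all admissible $\kappa$ and all $0<\varepsilon\le1$ there is a number of epochs $S\ge1$ for which the $p_{s,0},\dots,p_{s,K}$ are always probability vectors, $X_{\mathrm{out}}$ is a stochastic $\varepsilon$-stationary point, i.e. $\mathbb E\|\operatorname{grad}f(X_{\mathrm{out}})\|_{\mathsf F}^2\le\varepsilon$, and the run uses at most $A(\kappa)\,n/\varepsilon$ IFO calls and, for every induced constant $c$, at most $B(c)/\varepsilon$ retraction calls. That is, the complexities are $O(n/\varepsilon)$ and $O(1/\varepsilon)$ when $\kappa$ and $c$ are treated as constants. 2. Such choices exist uniformly in $n$: there are $\kappa_1,c_0>0$, depending only on the same constants, such that for every $n\ge1$ some admissible $\kappa\le\kappa_1$ has all its induced constants $\ge c_0$. -/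

import Mathlib

open scoped Matrix.Norms.Frobenius
open Matrix

namespace SVRGBB

/-- The Stiefel manifold of `d × r` matrices with orthonormal columns. The norm on matrices is the
Frobenius norm throughout. -/
def stiefel (d r : ℕ) : Set (Matrix (Fin d) (Fin r) ℝ) := {X | Xᵀ * X = 1}

/-- The Euclidean (Frobenius) inner product of two matrices. -/
def inn {d r : ℕ} (X Y : Matrix (Fin d) (Fin r) ℝ) : ℝ := (Xᵀ * Y).trace

/-- The Euclidean gradient: the matrix of partial derivatives of `f` at `X`. -/
noncomputable def euclGrad {d r : ℕ} (f : Matrix (Fin d) (Fin r) ℝ → ℝ)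
    (X : Matrix (Fin d) (Fin r) ℝ) : Matrix (Fin d) (Fin r) ℝ :=
  Matrix.of fun a b => fderiv ℝ f X (Matrix.single a b 1)

/-- The operator `D_ρ(X, Y) = (I - X Xᵀ) Y + 4 ρ X skew(Xᵀ Y)`. -/
noncomputable def dirOp {d r : ℕ} (ρ : ℝ) (X Y : Matrix (Fin d) (Fin r) ℝ) :
    Matrix (Fin d) (Fin r) ℝ :=
  (1 - X * Xᵀ) * Y + (4 * ρ) • (X * ((1 / 2 : ℝ) • (Xᵀ * Y - Yᵀ * X)))

/-- The Riemannian gradient `D_ρ(X, ∇f(X))`. For `ρ > 0` it is taken on the Stiefel manifold with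
the metric `⟨E₁, (I - (1 - 1/(4ρ)) X Xᵀ) E₂⟩`, for `ρ = 0` on the Grassmann manifold. -/
noncomputable def rieGrad {d r : ℕ} (ρ : ℝ) (f : Matrix (Fin d) (Fin r) ℝ → ℝ)
    (X : Matrix (Fin d) (Fin r) ℝ) : Matrix (Fin d) (Fin r) ℝ :=
  dirOp ρ X (euclGrad f X)

/-- The tangent space at `X` in which the search directions `D_ρ(X, ·)` lie: the one of the
Stiefel manifold for `ρ > 0`, the (horizontal) one of the Grassmann manifold for `ρ = 0`. -/
def tangent {d r : ℕ} (ρ : ℝ) (X : Matrix (Fin d) (Fin r) ℝ) :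
    Set (Matrix (Fin d) (Fin r) ℝ) :=
  {E | if ρ = 0 then Xᵀ * E = 0 else Xᵀ * E + Eᵀ * X = 0}

/-- `R` is a retraction: on each tangent space it is a smooth map into the manifold, and
`t ↦ R(X, tE)` has value `X` and velocity `E` at `t = 0`. -/
structure IsRetraction {d r : ℕ} (ρ : ℝ)
    (R : Matrix (Fin d) (Fin r) ℝ → Matrix (Fin d) (Fin r) ℝ → Matrix (Fin d) (Fin r) ℝ) :
    Prop where
  mapsTo : ∀ X ∈ stiefel d r, ∀ E ∈ tangent ρ X, R X E ∈ stiefel d r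
  smooth : ∀ X ∈ stiefel d r, ContDiffOn ℝ ((⊤ : ℕ∞) : WithTop ℕ∞) (R X) (tangent ρ X)
  map_zero : ∀ X ∈ stiefel d r, R X 0 = X
  deriv_zero : ∀ X ∈ stiefel d r, ∀ E ∈ tangent ρ X,
    HasDerivAt (fun t : ℝ => R X (t • E)) E 0

/-- `L₁`, `L₂` are first and second order constants of the retraction `R`. -/
def RetractionConstants {d r : ℕ} (ρ : ℝ)
    (R : Matrix (Fin d) (Fin r) ℝ → Matrix (Fin d) (Fin r) ℝ → Matrix (Fin d) (Fin r) ℝ)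
    (L₁ L₂ : ℝ) : Prop :=
  ∀ X ∈ stiefel d r, ∀ E ∈ tangent ρ X, ∀ t : ℝ, 0 ≤ t →
    ‖R X (t • E) - X‖ ≤ L₁ * t * ‖E‖ ∧
    ‖R X (t • E) - X - t • E‖ ≤ L₂ * t ^ 2 * ‖E‖ ^ 2

/-- The objective `f = (1/n) ∑ f_i`. -/
noncomputable def avgFun {d r n : ℕ} (f : Fin n → Matrix (Fin d) (Fin r) ℝ → ℝ)
    (X : Matrix (Fin d) (Fin r) ℝ) : ℝ := (∑ i, f i X) / n

/-- The constants that the parameters of the method are computed from. -/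
structure Consts where
  /-- number of columns -/
  r : ℕ
  /-- direction parameter of `D_ρ` -/
  ρ : ℝ
  /-- Lipschitz constant of the Euclidean gradients of the components -/
  L : ℝ
  /-- first order retraction constant -/
  L₁ : ℝ
  /-- second order retraction constant -/
  L₂ : ℝ
  /-- bound on the Euclidean gradient of the objective on the manifold -/
  C : ℝ
  /-- exponent of the parameter choice -/
  μ : ℝ
  /-- lower safeguard of the Barzilai-Borwein step -/
  τmin : ℝ
  /-- upper safeguard of the Barzilai-Borwein step -/
  τmax : ℝ

namespace Consts

/-- `ν = min {1, 1/(4ρ)}`, read as `1` for `ρ = 0`. -/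
noncomputable def ν (P : Consts) : ℝ := if P.ρ = 0 then 1 else min 1 (1 / (4 * P.ρ))

/-- `L̃ = L₁² + 4 L₂ √r`. -/
noncomputable def Ltilde (P : Consts) : ℝ := P.L₁ ^ 2 + 4 * P.L₂ * √(P.r : ℝ)

/-- `L̂ = 2 L₂ C + L₁² L`. -/
noncomputable def Lhat (P : Consts) : ℝ := 2 * P.L₂ * P.C + P.L₁ ^ 2 * P.L

/-- Number of inner iterations `K = ⌈(κ n)^{1/(3(1-μ))}⌉`. -/
noncomputable def K (P : Consts) (n : ℕ) (κ : ℝ) : ℕ := ⌈(κ * n) ^ (1 / (3 * (1 - P.μ)))⌉₊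

/-- Mini-batch size `|B| = ⌈K^{2-3μ}⌉`. -/
noncomputable def batch (P : Consts) (n : ℕ) (κ : ℝ) : ℕ := ⌈(P.K n κ : ℝ) ^ (2 - 3 * P.μ)⌉₊

/-- `β = (√L̃ L / ν) K^{μ-1}`. -/
noncomputable def β (P : Consts) (n : ℕ) (κ : ℝ) : ℝ :=
  √P.Ltilde * P.L / P.ν * (P.K n κ : ℝ) ^ (P.μ - 1)

/-- `c` is an induced constant: `c = ϱ K^{μ-1}` for some `ϱ` with
`ϱ ν / (√L̃ L) ∈ [τmin, τmax]`. These are the `c` for which `(c ν / (√L̃ L)) K^{-μ}` is a possible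
value `τ^{LBB} / K` of the step size. -/
def IsInduced (P : Consts) (n : ℕ) (κ c : ℝ) : Prop :=
  ∃ ϱ : ℝ, ϱ * P.ν / (√P.Ltilde * P.L) ∈ Set.Icc P.τmin P.τmax ∧
    c = ϱ * (P.K n κ : ℝ) ^ (P.μ - 1)

/-- `κ` is chosen such that every induced constant lies in `(0, 1)` and satisfies
`(L̂ / (√L̃ L)) exp(c² + 2c) c ≤ 1`. -/
def Admissible (P : Consts) (n : ℕ) (κ : ℝ) : Prop :=
  ∀ c : ℝ, P.IsInduced n κ c → c ∈ Set.Ioo (0 : ℝ) 1 ∧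
    P.Lhat / (√P.Ltilde * P.L) * Real.exp (c ^ 2 + 2 * c) * c ≤ 1

/-- `Γ(z, i) = ((1 + z)^{i-1} - 1) / z`. -/
noncomputable def Gam (z : ℝ) (i : ℕ) : ℝ := ((1 + z) ^ (i - 1) - 1) / z

/-- The quantity `Δ_k` belonging to an epoch with step size `τ`. -/
noncomputable def Delta (P : Consts) (n : ℕ) (κ τ : ℝ) (k : ℕ) : ℝ :=
  τ * (P.ν - P.Lhat * τ / 2 *
    (1 + (1 + 2 / (P.Ltilde * P.β n κ * τ))
      * (P.Ltilde * P.L ^ 2 * τ ^ 2 / (P.ν ^ 2 * P.batch n κ))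
      * Gam (2 * P.β n κ * τ + P.Ltilde * P.L ^ 2 * τ ^ 2 / (P.ν ^ 2 * P.batch n κ))
          (P.K n κ - k)))

/-- The output probabilities of an epoch with step size `τ`: `p_k = Δ_k / ∑_{j<K} Δ_j` for
`k < K` and `p_K = 0`. -/
noncomputable def prob (P : Consts) (n : ℕ) (κ τ : ℝ) (k : ℕ) : ℝ :=
  if k < P.K n κ then P.Delta n κ τ k / ∑ j ∈ Finset.range (P.K n κ), P.Delta n κ τ j else 0

end Consts

/-- The input of a run: components, retraction, starting point, safeguarded step for the first epoch
(where the Barzilai-Borwein quotient is not defined), and `κ`. -/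
structure Input (d r n : ℕ) where
  f : Fin n → Matrix (Fin d) (Fin r) ℝ → ℝ
  R : Matrix (Fin d) (Fin r) ℝ → Matrix (Fin d) (Fin r) ℝ → Matrix (Fin d) (Fin r) ℝ
  X₀ : Matrix (Fin d) (Fin r) ℝ
  τ₀ : ℝ
  κ : ℝ

/-- State of the method during a run. -/
structure State (d r : ℕ) where
  /-- number of epochs begun -/
  epoch : ℕ
  /-- current iterate `X^{s,k}` -/
  x : Matrix (Fin d) (Fin r) ℝ
  /-- starting point `X^{s,0}` of the most recently begun epoch -/
  anchor : Matrix (Fin d) (Fin r) ℝ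
  /-- step size `τ_s` of the most recently begun epoch -/
  step : ℝ
  /-- component gradients evaluated so far -/
  ifo : ℕ
  /-- retractions evaluated so far -/
  ro : ℕ

section Algorithm

variable {d n : ℕ} (P : Consts) (I : Input d P.r n)

/-- The safeguarded Barzilai-Borwein step computed from two consecutive epoch starting points:
`max {τmin, min {⟨S,S⟩ / |⟨S,Y⟩|, τmax}}`, where a quotient with zero denominator counts as `+∞`. -/
noncomputable def lbb (X Xprev : Matrix (Fin d) (Fin P.r) ℝ) : ℝ :=
  let S := X - Xprev
  let Y := rieGrad P.ρ (avgFun I.f) X - rieGrad P.ρ (avgFun I.f) Xprev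
  if inn S Y = 0 then P.τmax else max P.τmin (min (inn S S / |inn S Y|) P.τmax)

/-- The initial state, before the first epoch. -/
def start : State d P.r :=
  { epoch := 0, x := I.X₀, anchor := I.X₀, step := 0, ifo := 0, ro := 0 }

/-- Begin an epoch: compute the full gradient (`n` component gradients) and the step size
`τ_s = τ_s^{LBB} / K`. -/
noncomputable def beginEpoch (σ : State d P.r) : State d P.r :=
  { epoch := σ.epoch + 1
    x := σ.x
    anchor := σ.x
    step := (if σ.epoch = 0 then I.τ₀ else lbb P I σ.x σ.anchor) / (P.K n I.κ)
    ifo := σ.ifo + n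
    ro := σ.ro }

/-- The stochastic Euclidean gradient for the mini-batch `B` (drawn with replacement). -/
noncomputable def stochGrad (σ : State d P.r) (B : Fin (P.batch n I.κ) → Fin n) :
    Matrix (Fin d) (Fin P.r) ℝ :=
  euclGrad (avgFun I.f) σ.anchor +
    (1 / (P.batch n I.κ : ℝ)) • ∑ j, (euclGrad (I.f (B j)) σ.x - euclGrad (I.f (B j)) σ.anchor)

/-- An inner iteration: two component gradients per element of the mini-batch, one retraction. -/
noncomputable def innerStep (σ : State d P.r) (B : Fin (P.batch n I.κ) → Fin n) : State d P.r :=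
  { epoch := σ.epoch
    x := I.R σ.x (-(σ.step • dirOp P.ρ σ.x (stochGrad P I σ B)))
    anchor := σ.anchor
    step := σ.step
    ifo := σ.ifo + 2 * P.batch n I.κ
    ro := σ.ro + 1 }

/-- The sample space of a run with `S` epochs: all mini-batches, with the uniform distribution. -/
abbrev Sample (P : Consts) (n : ℕ) (κ : ℝ) (S : ℕ) : Type :=
  Fin S → Fin (P.K n κ) → Fin (P.batch n κ) → Fin n

/-- A complete epoch with the given mini-batches. -/
noncomputable def runEpoch (σ : State d P.r)
    (Bs : Fin (P.K n I.κ) → Fin (P.batch n I.κ) → Fin n) : State d P.r :=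
  (List.ofFn Bs).foldl (innerStep P I) (beginEpoch P I σ)

/-- The state at the end of the run. -/
noncomputable def finalState {S : ℕ} (w : Sample P n I.κ S) : State d P.r :=
  (List.ofFn w).foldl (runEpoch P I) (start P I)

/-- The state in epoch `s` after `k` inner iterations. -/
noncomputable def stateAt {S : ℕ} (w : Sample P n I.κ S) (s : Fin S) (k : ℕ) : State d P.r :=
  ((List.ofFn (w s)).take k).foldl (innerStep P I)
    (beginEpoch P I (((List.ofFn w).take s).foldl (runEpoch P I) (start P I)))

/-- The probability that epoch `s` of the run selects `X^{s,k}`. -/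
noncomputable def selectProb {S : ℕ} (w : Sample P n I.κ S) (s : Fin S) (k : ℕ) : ℝ :=
  P.prob n I.κ (stateAt P I w s 0).step k

/-- `𝔼 ‖grad f(X_r)‖²` for the returned point `X_r`: the mini-batches are independent and uniform, in
each epoch `X_r^s = X^{s,k}` with probability `p_{s,k}`, and `X_r` is uniform among the `X_r^s`. -/
noncomputable def expSqGrad (S : ℕ) : ℝ :=
  (∑ w : Sample P n I.κ S,
    (∑ s : Fin S, ∑ k ∈ Finset.range (P.K n I.κ + 1),
      selectProb P I w s k * ‖rieGrad P.ρ (avgFun I.f) (stateAt P I w s k).x‖ ^ 2) / (S : ℝ))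
    / (Fintype.card (Sample P n I.κ S) : ℝ)

end Algorithm

/-- The standing assumptions on the constants. -/
structure Consts.Valid (P : Consts) : Prop where
  ρ_nonneg : 0 ≤ P.ρ
  L_pos : 0 < P.L
  one_le_L₁ : 1 ≤ P.L₁
  L₂_pos : 0 < P.L₂
  C_pos : 0 < P.C
  μ_nonneg : 0 ≤ P.μ
  μ_le : P.μ ≤ 2 / 3
  τmin_pos : 0 < P.τmin
  τmin_lt : P.τmin < P.τmax

/-- The standing assumptions on the input, with constants `P` and a bound `D` on the initial
optimality gap. -/
structure Input.Valid {d n : ℕ} (P : Consts) (D : ℝ) (I : Input d P.r n) : Prop where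
  start_mem : I.X₀ ∈ stiefel d P.r
  differentiable : ∀ i, ∀ X ∈ stiefel d P.r, DifferentiableAt ℝ (I.f i) X
  lipschitz : ∀ i, ∀ X ∈ stiefel d P.r, ∀ Y ∈ stiefel d P.r,
    ‖euclGrad (I.f i) X - euclGrad (I.f i) Y‖ ≤ P.L * ‖X - Y‖
  grad_bound : ∀ X ∈ stiefel d P.r, ‖euclGrad (avgFun I.f) X‖ ≤ P.C
  retraction : IsRetraction P.ρ I.R
  constants : RetractionConstants P.ρ I.R P.L₁ P.L₂
  gap : ∀ X ∈ stiefel d P.r, avgFun I.f I.X₀ - avgFun I.f X ≤ D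
  first_step : I.τ₀ ∈ Set.Icc P.τmin P.τmax
  κ_pos : 0 < I.κ
  admissible : P.Admissible n I.κ

end SVRGBB

/-! The proof is a Lyapunov argument for variance-reduced descent. Inside an epoch the potential is
`f(X)` plus a weight times the squared distance to the anchor. The weights solve a backward linear
recursion and vanish at the end of the epoch. They are chosen so that the variance of the stochastic
gradient, which is proportional to that distance, is paid for, and each inner iteration lowers the
mean potential by a fixed multiple of `τ ‖grad f‖²`. Admissibility of `κ` keeps every `Δ_k` between
`τν/2` and `τν`. The selection probabilities are therefore at most `2/K`, and an epoch lowers the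
mean of `f` by `gain` times its selection-weighted squared gradient. Telescoping over epochs gives
`expSqGrad_le`, so `S` of order `1/ε` suffices. The cost bounds follow from `K b = O(n)` and from
inverting the definition of an induced constant.

The delicate point is the descent inequality. Differentiability and the Lipschitz bound are
available only on the Stiefel manifold, so the segment from `X` to `R(X, E)` cannot be used. If `X +
Y` has full column rank, then `Y` is a Cayley transform of `X`. Rotating with constant angular
speeds `2 arctan √β_j` gives a curve inside the manifold whose speed and distance from `X` are
controlled by the chord (`hasShortPath_of_cayley`). Integrating along it yields `f Y ≤ f X + ⟨∇f X,
Y - X⟩ + L ‖Y - X‖²`. The rank condition is removed by a limit: along an analytic curve of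
orthogonal matrices starting at the identity, the determinant expressing the condition is analytic
and not identically zero, so it vanishes only at isolated points. Such a curve to `R(X, E)` is built
from a chain of Cayley steps, because `t ↦ R(X, tE)` is continuous.

This inequality has `L` where the usual one has `L/2`, so the quadratic coefficient is `quad = L₂C +
L₁²L` instead of `L̂/2`. The loss is harmless: admissibility bounds the full bracket with `L̂`, and
`quad < L̂` leaves the positive fraction `1 - quad/L̂ = L₂C/L̂`. -/

namespace SVRGBB

/-! ### The Frobenius inner product. -/

section Inner

variable {d r : ℕ}

theorem inn_eq_sum (X Y : Matrix (Fin d) (Fin r) ℝ) : inn X Y = ∑ a, ∑ b, X a b * Y a b := by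
  rw [Finset.sum_comm]
  simp [inn, trace, mul_apply]

theorem inn_comm (X Y : Matrix (Fin d) (Fin r) ℝ) : inn X Y = inn Y X := by
  simp only [inn_eq_sum, mul_comm]

theorem inn_add_left (X Y Z : Matrix (Fin d) (Fin r) ℝ) : inn (X + Y) Z = inn X Z + inn Y Z := by
  simp [inn, Matrix.add_mul]

theorem inn_add_right (X Y Z : Matrix (Fin d) (Fin r) ℝ) : inn X (Y + Z) = inn X Y + inn X Z := by
  simp [inn, Matrix.mul_add]

theorem inn_sub_left (X Y Z : Matrix (Fin d) (Fin r) ℝ) : inn (X - Y) Z = inn X Z - inn Y Z := by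
  simp [inn, Matrix.sub_mul]

theorem inn_sub_right (X Y Z : Matrix (Fin d) (Fin r) ℝ) : inn X (Y - Z) = inn X Y - inn X Z := by
  simp [inn, Matrix.mul_sub]

theorem inn_neg_right (X Y : Matrix (Fin d) (Fin r) ℝ) : inn X (-Y) = -inn X Y := by
  simp [inn]

theorem inn_smul_right (c : ℝ) (X Y : Matrix (Fin d) (Fin r) ℝ) :
    inn X (c • Y) = c * inn X Y := by
  simp [inn]

theorem inn_smul_left (c : ℝ) (X Y : Matrix (Fin d) (Fin r) ℝ) :
    inn (c • X) Y = c * inn X Y := by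
  simp [inn]

theorem inn_zero_right (X : Matrix (Fin d) (Fin r) ℝ) : inn X 0 = 0 := by simp [inn]

theorem inn_sum_right {ι : Type*} (s : Finset ι) (X : Matrix (Fin d) (Fin r) ℝ)
    (Y : ι → Matrix (Fin d) (Fin r) ℝ) : inn X (∑ i ∈ s, Y i) = ∑ i ∈ s, inn X (Y i) := by
  simp [inn, Matrix.mul_sum, trace_sum]

theorem inn_mul_left {e : ℕ} (A : Matrix (Fin e) (Fin d) ℝ) (X : Matrix (Fin d) (Fin r) ℝ)
    (Y : Matrix (Fin e) (Fin r) ℝ) : inn (A * X) Y = inn X (Aᵀ * Y) := by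
  simp [inn, Matrix.mul_assoc]

theorem inn_mul_right {e : ℕ} (A : Matrix (Fin e) (Fin d) ℝ) (X : Matrix (Fin d) (Fin r) ℝ)
    (Y : Matrix (Fin e) (Fin r) ℝ) : inn Y (A * X) = inn (Aᵀ * Y) X := by
  simp [inn, Matrix.mul_assoc]

theorem inn_transpose (X Y : Matrix (Fin d) (Fin r) ℝ) : inn Xᵀ Yᵀ = inn X Y := by
  rw [inn_eq_sum, inn_eq_sum, Finset.sum_comm]
  simp

theorem norm_sq_eq_sum (X : Matrix (Fin d) (Fin r) ℝ) : ‖X‖ ^ 2 = ∑ a, ∑ b, X a b ^ 2 := by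
  rw [frobenius_norm_def, ← Real.sqrt_eq_rpow, Real.sq_sqrt (by positivity)]
  simp

theorem norm_sq_eq_inn (X : Matrix (Fin d) (Fin r) ℝ) : ‖X‖ ^ 2 = inn X X := by
  rw [norm_sq_eq_sum, inn_eq_sum]
  simp only [sq]

theorem norm_add_sq_inn (X Y : Matrix (Fin d) (Fin r) ℝ) :
    ‖X + Y‖ ^ 2 = ‖X‖ ^ 2 + 2 * inn X Y + ‖Y‖ ^ 2 := by
  simp only [norm_sq_eq_inn, inn_add_left, inn_add_right, inn_comm Y X]
  ring

theorem abs_inn_le (X Y : Matrix (Fin d) (Fin r) ℝ) : |inn X Y| ≤ ‖X‖ * ‖Y‖ := by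
  refine abs_le_of_sq_le_sq ?_ (by positivity)
  rw [mul_pow, norm_sq_eq_sum, norm_sq_eq_sum, inn_eq_sum]
  simp only [← Fintype.sum_prod_type', ]
  exact Finset.sum_mul_sq_le_sq_mul_sq _ (fun p : Fin d × Fin r => X p.1 p.2) fun p => Y p.1 p.2

theorem inn_le (X Y : Matrix (Fin d) (Fin r) ℝ) : inn X Y ≤ ‖X‖ * ‖Y‖ :=
  (le_abs_self _).trans (abs_inn_le X Y)

theorem norm_of_mem_stiefel {X : Matrix (Fin d) (Fin r) ℝ} (hX : X ∈ stiefel d r) :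
    ‖X‖ = √(r : ℝ) := by
  have h : ‖X‖ ^ 2 = r := by
    rw [norm_sq_eq_inn, inn, show Xᵀ * X = 1 from hX]
    simp
  rw [← h, Real.sqrt_sq (norm_nonneg _)]

theorem norm_sub_le_of_mem_stiefel {X Y : Matrix (Fin d) (Fin r) ℝ} (hX : X ∈ stiefel d r)
    (hY : Y ∈ stiefel d r) : ‖X - Y‖ ≤ 2 * √(r : ℝ) := by
  have := norm_sub_le X Y
  rw [norm_of_mem_stiefel hX, norm_of_mem_stiefel hY] at this
  linarith

end Inner

/-! ### The search direction `D_ρ(X, ·)`. -/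

section Direction

variable {d r : ℕ}

theorem dirOp_add (ρ : ℝ) (X Y Z : Matrix (Fin d) (Fin r) ℝ) :
    dirOp ρ X (Y + Z) = dirOp ρ X Y + dirOp ρ X Z := by
  simp only [dirOp, Matrix.mul_add, transpose_add, Matrix.add_mul, Matrix.mul_sub, smul_sub,
    smul_add, Matrix.mul_smul]
  abel

theorem dirOp_zero (ρ : ℝ) (X : Matrix (Fin d) (Fin r) ℝ) : dirOp ρ X 0 = 0 := by
  simp [dirOp]

theorem dirOp_sum {ι : Type*} (s : Finset ι) (ρ : ℝ) (X : Matrix (Fin d) (Fin r) ℝ)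
    (Y : ι → Matrix (Fin d) (Fin r) ℝ) :
    dirOp ρ X (∑ i ∈ s, Y i) = ∑ i ∈ s, dirOp ρ X (Y i) := by
  classical
  induction s using Finset.induction_on with
  | empty => simp [dirOp_zero]
  | insert a s ha ih => rw [Finset.sum_insert ha, Finset.sum_insert ha, dirOp_add, ih]

theorem transpose_mul_dirOp (ρ : ℝ) {X : Matrix (Fin d) (Fin r) ℝ} (hX : X ∈ stiefel d r)
    (Y : Matrix (Fin d) (Fin r) ℝ) :
    Xᵀ * dirOp ρ X Y = (4 * ρ) • ((1 / 2 : ℝ) • (Xᵀ * Y - Yᵀ * X)) := by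
  have hX' : Xᵀ * X = 1 := hX
  rw [dirOp, Matrix.mul_add, ← Matrix.mul_assoc, Matrix.mul_sub, ← Matrix.mul_assoc, hX',
    Matrix.mul_smul, ← Matrix.mul_assoc, hX']
  simp

theorem smul_dirOp_mem_tangent (ρ t : ℝ) {X : Matrix (Fin d) (Fin r) ℝ} (hX : X ∈ stiefel d r)
    (Y : Matrix (Fin d) (Fin r) ℝ) : t • dirOp ρ X Y ∈ tangent ρ X := by
  have h := transpose_mul_dirOp ρ hX Y
  rw [tangent, Set.mem_ofPred_eq]
  split_ifs with hρ
  · rw [Matrix.mul_smul, h, hρ]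
    simp
  · have h2 : (dirOp ρ X Y)ᵀ * X = -(Xᵀ * dirOp ρ X Y) := by
      rw [← transpose_transpose X, ← transpose_mul, transpose_transpose, h]
      simp only [transpose_smul, transpose_sub, transpose_mul, transpose_transpose, ← smul_neg,
        neg_sub]
    rw [Matrix.mul_smul, transpose_smul, Matrix.smul_mul, h2, smul_neg, add_neg_cancel]

/-- The normal part `(I - XXᵀ)Y` and the part `X S`, with `S` the skew part of `XᵀY`, are
orthogonal, and left multiplication by `X` is an isometry. Pairing `Y` with `X S` sees only the skew
part of `XᵀY`. -/
theorem inn_dirOp {X : Matrix (Fin d) (Fin r) ℝ} (hX : X ∈ stiefel d r) (ρ : ℝ)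
    (Y : Matrix (Fin d) (Fin r) ℝ) :
    inn Y (dirOp ρ X Y) = ‖(1 - X * Xᵀ) * Y‖ ^ 2
        + 4 * ρ * ‖(1 / 2 : ℝ) • (Xᵀ * Y - Yᵀ * X)‖ ^ 2 ∧
      ‖dirOp ρ X Y‖ ^ 2 = ‖(1 - X * Xᵀ) * Y‖ ^ 2
        + 16 * ρ ^ 2 * ‖(1 / 2 : ℝ) • (Xᵀ * Y - Yᵀ * X)‖ ^ 2 := by
  have hX' : Xᵀ * X = 1 := hX
  set S : Matrix (Fin r) (Fin r) ℝ := (1 / 2 : ℝ) • (Xᵀ * Y - Yᵀ * X) with hS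
  set Q : Matrix (Fin d) (Fin r) ℝ := (1 - X * Xᵀ) * Y with hQ
  have h0 : Xᵀ * Q = 0 := by
    rw [hQ, ← Matrix.mul_assoc, Matrix.mul_sub, ← Matrix.mul_assoc, hX']
    simp
  have h1 : inn Q (X * S) = 0 := by
    rw [inn_mul_right, h0]
    simp [inn]
  have h2 : inn (X * S) (X * S) = ‖S‖ ^ 2 := by
    rw [inn_mul_left, ← Matrix.mul_assoc, hX', Matrix.one_mul, norm_sq_eq_inn]
  have h3 : inn Y Q = ‖Q‖ ^ 2 := by
    have : Y = Q + X * (Xᵀ * Y) := by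
      rw [hQ, Matrix.sub_mul, Matrix.one_mul, Matrix.mul_assoc, sub_add_cancel]
    have h4 : inn (X * (Xᵀ * Y)) Q = 0 := by
      rw [inn_mul_left, h0, inn_zero_right]
    rw [norm_sq_eq_inn]
    nth_rewrite 1 [this]
    rw [inn_add_left, h4, add_zero]
  have h5 : inn Y (X * S) = ‖S‖ ^ 2 := by
    have hT : Sᵀ = -S := by
      rw [hS]
      simp only [transpose_smul, transpose_sub, transpose_mul, transpose_transpose, ← smul_neg,
        neg_sub]
    have h6 : inn (Yᵀ * X) S = - inn (Xᵀ * Y) S := by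
      rw [← inn_transpose, hT, inn_neg_right, transpose_mul, transpose_transpose]
    rw [inn_mul_right, norm_sq_eq_inn]
    nth_rewrite 2 [hS]
    rw [inn_smul_left, inn_sub_left, h6]
    ring
  constructor
  · rw [dirOp, ← hS, ← hQ, inn_add_right, h3, inn_smul_right, h5]
  · rw [dirOp, ← hS, ← hQ, norm_add_sq_inn, inn_smul_right, h1, norm_sq_eq_inn (_ • _),
      inn_smul_right, inn_smul_left, h2]
    ring

end Direction

/-! ### The constant `ν` as a comparison constant for `D_ρ`. -/

section Constants

variable {P : Consts}

theorem Consts.Valid.ν_pos (hP : P.Valid) : 0 < P.ν := by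
  unfold Consts.ν
  have := hP.ρ_nonneg
  split_ifs with h
  · norm_num
  · have : 0 < P.ρ := lt_of_le_of_ne this (Ne.symm h)
    positivity

theorem Consts.ν_le_one : P.ν ≤ 1 := by
  unfold Consts.ν
  split_ifs <;> simp

theorem Consts.Valid.ν_mul_le (hP : P.Valid) : P.ν * (4 * P.ρ) ≤ 1 := by
  unfold Consts.ν
  have := hP.ρ_nonneg
  split_ifs with h
  · simp [h]
  · have h' : 0 < P.ρ := lt_of_le_of_ne this (Ne.symm h)
    calc min 1 (1 / (4 * P.ρ)) * (4 * P.ρ) ≤ 1 / (4 * P.ρ) * (4 * P.ρ) := by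
          gcongr
          exact min_le_right _ _
      _ = 1 := by field_simp

/-- The two orthogonal parts enter with weights `1, 4ρ` on one side and `1, 16ρ²` on the other. Thus
`ν ≤ 1` and `4ρν ≤ 1` are exactly what is needed. -/
theorem Consts.Valid.ν_mul_norm_dirOp_sq_le (hP : P.Valid) {d : ℕ}
    {X : Matrix (Fin d) (Fin P.r) ℝ} (hX : X ∈ stiefel d P.r) (Y : Matrix (Fin d) (Fin P.r) ℝ) :
    P.ν * ‖dirOp P.ρ X Y‖ ^ 2 ≤ inn Y (dirOp P.ρ X Y) := by
  obtain ⟨h1, h2⟩ := inn_dirOp hX P.ρ Y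
  rw [h1, h2, mul_add]
  have h3 := hP.ν_mul_le
  have h4 : P.ν ≤ 1 := Consts.ν_le_one
  have h5 := hP.ρ_nonneg
  refine add_le_add (mul_le_of_le_one_left (by positivity) h4) ?_
  rw [← mul_assoc]
  refine mul_le_mul_of_nonneg_right ?_ (by positivity)
  nlinarith

theorem Consts.Valid.ν_mul_norm_dirOp_le (hP : P.Valid) {d : ℕ}
    {X : Matrix (Fin d) (Fin P.r) ℝ} (hX : X ∈ stiefel d P.r) (Y : Matrix (Fin d) (Fin P.r) ℝ) :
    P.ν * ‖dirOp P.ρ X Y‖ ≤ ‖Y‖ := by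
  have h := (hP.ν_mul_norm_dirOp_sq_le hX Y).trans (inn_le _ _)
  rcases (norm_nonneg (dirOp P.ρ X Y)).eq_or_lt' with h0 | h0
  · rw [h0]
    simp
  · refine le_of_mul_le_mul_right ?_ h0
    linarith

end Constants

/-! ### Euclidean gradients of the components and of their average. -/

section Gradient

variable {d r n : ℕ}

theorem fderiv_eq_inn_euclGrad (f : Matrix (Fin d) (Fin r) ℝ → ℝ)
    (X V : Matrix (Fin d) (Fin r) ℝ) : fderiv ℝ f X V = inn (euclGrad f X) V := by
  conv_lhs => rw [matrix_eq_sum_single V]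
  simp only [map_sum, inn_eq_sum, euclGrad, of_apply]
  refine Finset.sum_congr rfl fun a _ => Finset.sum_congr rfl fun b _ => ?_
  have : Matrix.single a b (V a b) = V a b • Matrix.single a b (1 : ℝ) := by
    rw [smul_single, smul_eq_mul, mul_one]
  rw [this, map_smul, smul_eq_mul, mul_comm]

theorem euclGrad_avgFun {f : Fin n → Matrix (Fin d) (Fin r) ℝ → ℝ} {X : Matrix (Fin d) (Fin r) ℝ}
    (hf : ∀ i, DifferentiableAt ℝ (f i) X) :
    euclGrad (avgFun f) X = (1 / (n : ℝ)) • ∑ i, euclGrad (f i) X := by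
  have h : HasFDerivAt (avgFun f) ((n : ℝ)⁻¹ • ∑ i, fderiv ℝ (f i) X) X := by
    have := (HasFDerivAt.fun_sum fun i (_ : i ∈ Finset.univ) => (hf i).hasFDerivAt).const_smul
      ((n : ℝ)⁻¹)
    refine this.congr_of_eventuallyEq (Filter.Eventually.of_forall fun Z => ?_)
    simp [avgFun, div_eq_inv_mul]
  ext a b
  simp [euclGrad, h.fderiv, Matrix.sum_apply]

theorem differentiableAt_avgFun {f : Fin n → Matrix (Fin d) (Fin r) ℝ → ℝ}
    {X : Matrix (Fin d) (Fin r) ℝ} (hf : ∀ i, DifferentiableAt ℝ (f i) X) :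
    DifferentiableAt ℝ (avgFun f) X := by
  have h : DifferentiableAt ℝ (fun Z => ∑ i, f i Z) X := DifferentiableAt.fun_sum fun i _ => hf i
  refine (h.const_smul ((n : ℝ)⁻¹)).congr_of_eventuallyEq (Filter.Eventually.of_forall fun Z => ?_)
  simp [avgFun, div_eq_inv_mul]

end Gradient

/-! ### Uniform averages and a supermartingale inequality for folds. -/

section Average

variable {α σ : Type*} [Fintype α]

/-- The mean of `F` under the uniform distribution. -/
noncomputable def avg (F : α → ℝ) : ℝ := (∑ a, F a) / Fintype.card α

theorem avg_add (F G : α → ℝ) : avg (fun a => F a + G a) = avg F + avg G := by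
  simp [avg, Finset.sum_add_distrib, add_div]

theorem avg_sub (F G : α → ℝ) : avg (fun a => F a - G a) = avg F - avg G := by
  simp [avg, Finset.sum_sub_distrib, sub_div]

theorem avg_const_mul (c : ℝ) (F : α → ℝ) : avg (fun a => c * F a) = c * avg F := by
  simp [avg, ← Finset.mul_sum, mul_div_assoc]

theorem avg_sum {ι : Type*} (s : Finset ι) (F : ι → α → ℝ) :
    avg (fun a => ∑ i ∈ s, F i a) = ∑ i ∈ s, avg (F i) := by
  simp only [avg]
  rw [Finset.sum_comm, Finset.sum_div]

theorem avg_const [Nonempty α] (c : ℝ) : avg (fun _ : α => c) = c := by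
  simp [avg]

theorem avg_mono {F G : α → ℝ} (h : ∀ a, F a ≤ G a) : avg F ≤ avg G := by
  unfold avg
  gcongr
  exact h _

theorem avg_cons {N : ℕ} (F : (Fin (N + 1) → α) → ℝ) :
    avg F = avg fun a => avg fun w => F (Fin.cons a w) := by
  simp only [avg, Finset.sum_div, Fintype.card_fun, Fintype.card_fin, div_div]
  rw [← (Fin.consEquiv fun _ : Fin (N + 1) => α).sum_comp, Fintype.sum_prod_type]
  refine Finset.sum_congr rfl fun a _ => Finset.sum_congr rfl fun w _ => ?_
  rw [pow_succ, Nat.cast_mul]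
  rfl

/-- Finite supermartingale argument: a potential `V k` whose one-step average drops by at least the
mean of `ψ k` bounds the expected total of the `ψ k`. It serves twice, for the inner iterations of
an epoch and for the epochs of a run. Since `V` and `ψ` are quantified inside the induction, they
can be shifted by one index when the first sample is split off. -/
theorem avg_foldl_le [Nonempty α] (step : σ → α → σ) (Inv : σ → Prop)
    (hinv : ∀ x a, Inv x → Inv (step x a)) (N : ℕ) :
    ∀ (V : ℕ → σ → ℝ) (ψ : ℕ → σ → α → ℝ)
      (_ : ∀ k < N, ∀ x, Inv x → (avg fun a => V (k + 1) (step x a) + ψ k x a) ≤ V k x)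
      (x : σ) (_ : Inv x),
      (avg fun w : Fin N → α => V N ((List.ofFn w).foldl step x)
        + ∑ k : Fin N, ψ k (((List.ofFn w).take k).foldl step x) (w k)) ≤ V 0 x := by
  induction N with
  | zero =>
    intro V ψ _ x _
    simp [avg]
  | succ N ih =>
    intro V ψ h x hx
    rw [avg_cons]
    refine le_trans (avg_mono fun a => ?_) (h 0 (Nat.succ_pos N) x hx)
    have key := ih (fun k => V (k + 1)) (fun k => ψ (k + 1))
      (fun k hk y hy => h (k + 1) (Nat.succ_lt_succ hk) y hy) (step x a) (hinv x a hx)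
    have h1 := add_le_add_left key (ψ 0 x a)
    rw [← avg_const (α := Fin N → α) (ψ 0 x a), ← avg_add] at h1
    refine le_of_eq_of_le ?_ (h1.trans_eq ?_)
    · congr 1
      funext w
      rw [Fin.sum_univ_succ]
      simp [List.ofFn_succ]
      ring
    · rw [avg_const]

theorem avg_sum_pi [Nonempty α] {y : α → ℝ} (hy : avg y = 0) (b : ℕ) :
    (avg fun B : Fin b → α => ∑ j, y (B j)) = 0 := by
  induction b with
  | zero => simp [avg]
  | succ b ih =>
    rw [avg_cons]
    simp only [Fin.sum_univ_succ, Fin.cons_zero, Fin.cons_succ, avg_add, avg_const, ih, hy,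
      add_zero]

/-- Independence: the cross terms of centred samples average to zero. -/
theorem avg_sq_sum_pi [Nonempty α] {y : α → ℝ} (hy : avg y = 0) (b : ℕ) :
    (avg fun B : Fin b → α => (∑ j, y (B j)) ^ 2) = b * avg fun a => y a ^ 2 := by
  induction b with
  | zero => simp [avg]
  | succ b ih =>
    rw [avg_cons]
    simp only [Fin.sum_univ_succ, Fin.cons_zero, Fin.cons_succ, add_sq, avg_add, avg_const, ih,
      avg_const_mul, avg_sum_pi hy, mul_zero]
    push_cast
    ring

end Average

/-! ### Mini-batch means: unbiasedness and variance. -/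

section Sampling

variable {α : Type*} [Fintype α] [Nonempty α] {d r : ℕ}

theorem sum_sampling_error (ξ : α → Matrix (Fin d) (Fin r) ℝ) {b : ℕ} (hb : 0 < b) :
    ∑ B : Fin b → α, ((1 / (b : ℝ)) • ∑ j, ξ (B j) - (1 / (Fintype.card α : ℝ)) • ∑ i, ξ i)
      = 0 := by
  ext p q
  set m : ℝ := avg fun a => ξ a p q with hm
  have hy : (avg fun a => ξ a p q - m) = 0 := by
    rw [avg_sub, avg_const, sub_self]
  have h := avg_sum_pi hy b
  rw [avg, div_eq_zero_iff, or_iff_left (by positivity)] at h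
  have hb' : (b : ℝ) ≠ 0 := by positivity
  have h2 : ∀ B : Fin b → α, ((1 / (b : ℝ)) • ∑ j, ξ (B j)
      - (1 / (Fintype.card α : ℝ)) • ∑ i, ξ i) p q = (1 / b) * ∑ j, (ξ (B j) p q - m) := by
    intro B
    simp only [Matrix.sub_apply, Matrix.smul_apply, Matrix.sum_apply, smul_eq_mul,
      Finset.sum_sub_distrib, Finset.sum_const, Finset.card_univ, Fintype.card_fin, nsmul_eq_mul,
      hm, avg]
    field_simp
  rw [Matrix.sum_apply, Finset.sum_congr rfl fun B _ => h2 B, ← Finset.mul_sum, h]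
  simp

/-- Entry by entry, the variance of a mean of `b` independent samples is `1/b` times the variance of
one, and the variance is at most the second moment. -/
theorem avg_norm_sampling_error_sq_le (ξ : α → Matrix (Fin d) (Fin r) ℝ) {b : ℕ} (hb : 0 < b) :
    (avg fun B : Fin b → α =>
      ‖(1 / (b : ℝ)) • ∑ j, ξ (B j) - (1 / (Fintype.card α : ℝ)) • ∑ i, ξ i‖ ^ 2)
      ≤ (1 / b) * avg fun a => ‖ξ a‖ ^ 2 := by
  simp only [norm_sq_eq_sum, avg_sum, Finset.mul_sum]
  refine Finset.sum_le_sum fun p _ => Finset.sum_le_sum fun q _ => ?_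
  set m : ℝ := avg fun a => ξ a p q with hm
  have hy : (avg fun a => ξ a p q - m) = 0 := by
    rw [avg_sub, avg_const, sub_self]
  have h := avg_sq_sum_pi hy b
  have hb' : (b : ℝ) ≠ 0 := by positivity
  have h2 : ∀ B : Fin b → α, (((1 / (b : ℝ)) • ∑ j, ξ (B j)
      - (1 / (Fintype.card α : ℝ)) • ∑ i, ξ i) p q) ^ 2
      = (1 / b) ^ 2 * (∑ j, (ξ (B j) p q - m)) ^ 2 := by
    intro B
    simp only [Matrix.sub_apply, Matrix.smul_apply, Matrix.sum_apply, smul_eq_mul,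
      Finset.sum_sub_distrib, Finset.sum_const, Finset.card_univ, Fintype.card_fin, nsmul_eq_mul,
      hm, avg]
    rw [← mul_pow]
    congr 1
    field_simp
  have h3 : (avg fun a => (ξ a p q - m) ^ 2) = (avg fun a => ξ a p q ^ 2) - m ^ 2 := by
    have : ∀ a, (ξ a p q - m) ^ 2 = (ξ a p q ^ 2 - (2 * m) * ξ a p q) + m ^ 2 := fun a => by ring
    simp only [this, avg_add, avg_sub, avg_const_mul, avg_const, ← hm]
    ring
  simp only [h2, avg_const_mul, h, h3]
  have : (1 / (b : ℝ)) ^ 2 * (b * ((avg fun a => ξ a p q ^ 2) - m ^ 2))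
      = 1 / b * (avg fun a => ξ a p q ^ 2) - 1 / b * m ^ 2 := by
    field_simp
  rw [this]
  have : 0 ≤ 1 / (b : ℝ) * m ^ 2 := by positivity
  linarith

end Sampling

/-- The quotient `sin (t y) / sin y` increases on `(0, π/2]` and equals `sin (π t / 2)` at `π/2`.
The numerator of its derivative vanishes at `0` and has derivative `(1 - t²) sin (t y) sin y ≥ 0`.
-/
theorem sin_mul_le_sin_mul_sin {t x : ℝ} (ht0 : 0 ≤ t) (ht1 : t ≤ 1) (hx0 : 0 ≤ x)
    (hx : x ≤ Real.pi / 2) : Real.sin (t * x) ≤ Real.sin (Real.pi * t / 2) * Real.sin x := by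
  rcases hx0.eq_or_lt with rfl | hx0
  · simp
  have hpi := Real.pi_pos
  have hk : ∀ y ∈ Set.Icc 0 (Real.pi / 2),
      0 ≤ t * Real.cos (t * y) * Real.sin y - Real.sin (t * y) * Real.cos y := by
    have hd : ∀ y, HasDerivAt
        (fun y => t * Real.cos (t * y) * Real.sin y - Real.sin (t * y) * Real.cos y)
        ((1 - t ^ 2) * (Real.sin (t * y) * Real.sin y)) y := by
      intro y
      have h1 : HasDerivAt (fun y => t * y) t y := by simpa using (hasDerivAt_id y).const_mul t
      convert! (((h1.cos.const_mul t).mul (Real.hasDerivAt_sin y)).sub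
        (h1.sin.mul (Real.hasDerivAt_cos y))) using 1
      ring
    have hm : MonotoneOn
        (fun y => t * Real.cos (t * y) * Real.sin y - Real.sin (t * y) * Real.cos y)
        (Set.Icc 0 (Real.pi / 2)) := by
      refine monotoneOn_of_deriv_nonneg (convex_Icc _ _)
        (fun y _ => (hd y).continuousAt.continuousWithinAt)
        (fun y _ => (hd y).differentiableAt.differentiableWithinAt) fun y hy => ?_
      rw [interior_Icc] at hy
      rw [(hd y).deriv]
      have h2 : 0 ≤ Real.sin (t * y) := Real.sin_nonneg_of_nonneg_of_le_pi
        (mul_nonneg ht0 hy.1.le) (by nlinarith [hy.1, hy.2])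
      have h3 : 0 ≤ Real.sin y := Real.sin_nonneg_of_nonneg_of_le_pi hy.1.le (by linarith [hy.2])
      have h4 : 0 ≤ 1 - t ^ 2 := by nlinarith
      positivity
    intro y hy
    simpa using hm (Set.left_mem_Icc.2 (by positivity)) hy hy.1
  have hs : ∀ y ∈ Set.Ioc 0 (Real.pi / 2), 0 < Real.sin y := fun y hy =>
    Real.sin_pos_of_pos_of_lt_pi hy.1 (by linarith [hy.2])
  have hd : ∀ y ∈ Set.Ioc 0 (Real.pi / 2), HasDerivAt (fun y => Real.sin (t * y) / Real.sin y)
      ((t * Real.cos (t * y) * Real.sin y - Real.sin (t * y) * Real.cos y) / Real.sin y ^ 2) y := by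
    intro y hy
    have h1 : HasDerivAt (fun y => t * y) t y := by simpa using (hasDerivAt_id y).const_mul t
    convert! h1.sin.div (Real.hasDerivAt_sin y) (hs y hy).ne' using 1
    ring
  have hm : MonotoneOn (fun y => Real.sin (t * y) / Real.sin y) (Set.Ioc 0 (Real.pi / 2)) := by
    refine monotoneOn_of_deriv_nonneg (convex_Ioc _ _)
      (fun y hy => (hd y hy).continuousAt.continuousWithinAt)
      (fun y hy => (hd y (interior_subset hy)).differentiableAt.differentiableWithinAt)
      fun y hy => ?_
    have hy := interior_subset hy
    rw [(hd y hy).deriv]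
    exact div_nonneg (hk y ⟨hy.1.le, hy.2⟩) (by positivity)
  have := hm ⟨hx0, hx⟩ (Set.right_mem_Ioc.2 (by positivity)) hx
  simp only [Real.sin_pi_div_two, div_one] at this
  rw [div_le_iff₀ (hs x ⟨hx0, hx⟩)] at this
  rwa [show Real.pi * t / 2 = t * (Real.pi / 2) by ring]

/-! ### Skew matrices and the Cayley transform. -/

section Skew

variable {d r : ℕ}

theorem inn_skew_self {A : Matrix (Fin d) (Fin d) ℝ} (hA : Aᵀ = -A)
    (W : Matrix (Fin d) (Fin r) ℝ) : inn W (A * W) = 0 := by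
  have h : inn W (A * W) = -inn W (A * W) := by
    conv_lhs => rw [inn_mul_right, hA, Matrix.neg_mul, inn_comm, inn_neg_right]
  linarith

theorem eq_of_one_sub_skew_mul_eq {A : Matrix (Fin d) (Fin d) ℝ} (hA : Aᵀ = -A)
    {W W' : Matrix (Fin d) (Fin r) ℝ} (h : (1 - A) * W = (1 - A) * W') : W = W' := by
  have h1 : W - W' = A * (W - W') := by
    have : (1 - A) * (W - W') = 0 := by rw [Matrix.mul_sub, h, sub_self]
    rwa [Matrix.sub_mul, Matrix.one_mul, sub_eq_zero] at this
  have h2 : ‖W - W'‖ ^ 2 = 0 := by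
    rw [norm_sq_eq_inn]
    nth_rewrite 2 [h1]
    exact inn_skew_self hA _
  rwa [sq_eq_zero_iff, norm_eq_zero, sub_eq_zero] at h2

theorem isUnit_one_sub_skew {A : Matrix (Fin d) (Fin d) ℝ} (hA : Aᵀ = -A) : IsUnit (1 - A) := by
  rw [← Matrix.mulVec_injective_iff_isUnit]
  intro v w h
  have h1 : (1 - A) * replicateCol (Fin 1) v = (1 - A) * replicateCol (Fin 1) w := by
    rw [← replicateCol_mulVec, ← replicateCol_mulVec]
    exact congrArg _ h
  exact replicateCol_injective (eq_of_one_sub_skew_mul_eq hA h1)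

/-- The relation says `W - Y = A (W + Y)`. Skewness makes `(W + Y)ᵀ(W - Y)` skew, and twice `WᵀW -
YᵀY` is this matrix plus its transpose. -/
theorem transpose_mul_self_eq_of_cayley {A : Matrix (Fin d) (Fin d) ℝ} (hA : Aᵀ = -A)
    {W Y : Matrix (Fin d) (Fin r) ℝ} (h : (1 - A) * W = (1 + A) * Y) : Wᵀ * W = Yᵀ * Y := by
  have h1 : W - Y = A * (W + Y) := by
    rw [Matrix.sub_mul, Matrix.add_mul, Matrix.one_mul, Matrix.one_mul] at h
    rw [sub_eq_iff_eq_add] at h ⊢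
    rw [Matrix.mul_add]
    exact h.trans (by abel)
  have h2 : (W + Y)ᵀ * (W - Y) + (W - Y)ᵀ * (W + Y) = 0 := by
    rw [h1, transpose_mul, hA, ← Matrix.mul_assoc]
    simp
  have h3 : (2 : ℝ) • (Wᵀ * W - Yᵀ * Y) = 0 := by
    rw [← h2]
    simp only [transpose_add, transpose_sub, Matrix.add_mul, Matrix.mul_add, Matrix.sub_mul,
      Matrix.mul_sub, two_smul]
    abel
  exact sub_eq_zero.1 ((smul_eq_zero.1 h3).resolve_left two_ne_zero)

/-- With `Z = X + Y` and `E = Y - X`, the requirement is a skew `A` with `A Z = E`. The matrix `E G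
Zᵀ`, where `G = (ZᵀZ)⁻¹`, maps `Z` to `E`. Subtracting its transpose makes it skew and adds the
error `Z G ZᵀE`, which the third term cancels. That term is itself skew because `X` and `Y` both lie
on the manifold, which makes `ZᵀE` skew. -/
theorem exists_skew_of_isUnit {X Y : Matrix (Fin d) (Fin r) ℝ} (hX : X ∈ stiefel d r)
    (hY : Y ∈ stiefel d r) (h : IsUnit ((X + Y)ᵀ * (X + Y))) :
    ∃ A : Matrix (Fin d) (Fin d) ℝ, Aᵀ = -A ∧ (1 - A) * Y = (1 + A) * X := by
  have hX' : Xᵀ * X = 1 := hX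
  have hY' : Yᵀ * Y = 1 := hY
  set Z := X + Y with hZ
  set E := Y - X with hE
  set G := (Zᵀ * Z)⁻¹ with hG
  have hGT : Gᵀ = G := by rw [hG, transpose_nonsing_inv, transpose_mul, transpose_transpose]
  have hGZ : G * (Zᵀ * Z) = 1 :=
    Matrix.nonsing_inv_mul _ ((Matrix.isUnit_iff_isUnit_det _).1 h)
  have hK : Eᵀ * Z = -(Zᵀ * E) := by
    rw [hZ, hE]
    simp only [transpose_add, transpose_sub, Matrix.add_mul, Matrix.mul_add, Matrix.sub_mul,
      Matrix.mul_sub, hX', hY']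
    abel
  refine ⟨E * G * Zᵀ - Z * G * Eᵀ - Z * G * (Zᵀ * E) * G * Zᵀ, ?_, ?_⟩
  · simp only [transpose_sub, transpose_mul, transpose_transpose, hGT]
    rw [hK]
    simp only [Matrix.mul_assoc, Matrix.neg_mul, Matrix.mul_neg]
    abel
  · have h1 : (E * G * Zᵀ - Z * G * Eᵀ - Z * G * (Zᵀ * E) * G * Zᵀ) * Z = E := by
      simp only [Matrix.sub_mul]
      rw [Matrix.mul_assoc (E * G), Matrix.mul_assoc E, hGZ, Matrix.mul_assoc (Z * G) Eᵀ, hK,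
        Matrix.mul_assoc _ Zᵀ,
        Matrix.mul_assoc (Z * G * (Zᵀ * E)) G, hGZ]
      simp
    set A := E * G * Zᵀ - Z * G * Eᵀ - Z * G * (Zᵀ * E) * G * Zᵀ
    rw [hZ, hE, Matrix.mul_add] at h1
    rw [Matrix.sub_mul, Matrix.add_mul, Matrix.one_mul, Matrix.one_mul, sub_eq_iff_eq_add,
      add_assoc, h1]
    abel

/-- On the manifold `(X + Y)ᵀ(X + Y) = 4 (I - (Y - X)ᵀ(Y - X)/4)`, which a Neumann series inverts.
-/
theorem isUnit_add_of_norm_sub_lt {X Y : Matrix (Fin d) (Fin r) ℝ} (hX : X ∈ stiefel d r)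
    (hY : Y ∈ stiefel d r) (h : ‖Y - X‖ < 2) : IsUnit ((X + Y)ᵀ * (X + Y)) := by
  have hX' : Xᵀ * X = 1 := hX
  have hY' : Yᵀ * Y = 1 := hY
  have h1 : (X + Y)ᵀ * (X + Y) = (4 : ℝ) • (1 - (1 / 4 : ℝ) • ((Y - X)ᵀ * (Y - X))) := by
    rw [smul_sub, smul_smul]
    norm_num
    simp only [Matrix.add_mul, Matrix.mul_add, Matrix.sub_mul, Matrix.mul_sub, hX', hY']
    rw [show (4 : ℝ) • (1 : Matrix (Fin r) (Fin r) ℝ) = 1 + 1 + 1 + 1 by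
      rw [show (4 : ℝ) = 1 + 1 + 1 + 1 by norm_num]; simp only [add_smul, one_smul]]
    abel
  have h2 : ‖(1 / 4 : ℝ) • ((Y - X)ᵀ * (Y - X))‖ < 1 := by
    rw [norm_smul]
    have := frobenius_norm_mul (Y - X)ᵀ (Y - X)
    rw [frobenius_norm_transpose] at this
    rw [Real.norm_of_nonneg (by norm_num)]
    nlinarith [norm_nonneg (Y - X)]
  rw [h1]
  exact (isUnit_one_sub_of_norm_lt_one h2).smul (Units.mk0 (4 : ℝ) (by norm_num))

end Skew

/-! ### Curves in the manifold controlled by the chord. -/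

section ShortPath

variable {d r : ℕ}

/-- A differentiable curve in the Stiefel manifold from `X` to `Y` whose speed and whose distance
from `X` are controlled by the chord `‖Y - X‖`. -/
def HasShortPath (X Y : Matrix (Fin d) (Fin r) ℝ) : Prop :=
  ∃ γ γ' : ℝ → Matrix (Fin d) (Fin r) ℝ, γ 0 = X ∧ γ 1 = Y ∧
    (∀ t, HasDerivAt γ (γ' t) t) ∧ (∀ t, γ t ∈ stiefel d r) ∧
    (∀ t, ‖γ' t‖ ≤ Real.pi / 2 * ‖Y - X‖) ∧
    ∀ t ∈ Set.Icc (0 : ℝ) 1, ‖γ t - X‖ ≤ Real.sin (Real.pi * t / 2) * ‖Y - X‖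

/-- Since `A` commutes with `A²`, it couples only indices with equal `β`. Hence it commutes with
every diagonal matrix that is a function of `β`. -/
theorem mul_diagonal_comm_of_sq_eq {A : Matrix (Fin d) (Fin d) ℝ} {β : Fin d → ℝ}
    (h : A * A = -diagonal β) {p : Fin d → ℝ} (hp : ∀ i j, β i = β j → p i = p j) :
    A * diagonal p = diagonal p * A := by
  have h1 : A * diagonal β = diagonal β * A := by
    have : A * (A * A) = A * A * A := (Matrix.mul_assoc A A A).symm
    rw [h, Matrix.mul_neg, Matrix.neg_mul, neg_inj] at this
    exact this
  ext i j
  have h2 := congrFun (congrFun h1 i) j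
  rw [mul_diagonal, diagonal_mul] at h2 ⊢
  rcases eq_or_ne (A i j) 0 with h0 | h0
  · simp [h0]
  · have : β j = β i := mul_left_cancel₀ h0 (by linarith)
    rw [hp j i this, mul_comm]

theorem transpose_mul_self_diagonal_add {A : Matrix (Fin d) (Fin d) ℝ} (hA : Aᵀ = -A)
    {β : Fin d → ℝ} (h : A * A = -diagonal β) {p q : Fin d → ℝ}
    (hp : ∀ i j, β i = β j → p i = p j) (hq : ∀ i j, β i = β j → q i = q j) :
    (diagonal p + A * diagonal q)ᵀ * (diagonal p + A * diagonal q)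
      = diagonal fun j => p j ^ 2 + β j * q j ^ 2 := by
  have hcp := mul_diagonal_comm_of_sq_eq h hp
  have hcq := mul_diagonal_comm_of_sq_eq h hq
  have e1 : diagonal p * (A * diagonal q) = diagonal q * (A * diagonal p) := by
    rw [hcp, hcq, ← Matrix.mul_assoc, ← Matrix.mul_assoc, diagonal_mul_diagonal,
      diagonal_mul_diagonal]
    congr 2
    funext j
    ring
  have e2 : A * (A * diagonal q) = -(diagonal β * diagonal q) := by
    rw [← Matrix.mul_assoc, h, Matrix.neg_mul]
  rw [transpose_add, transpose_mul, hA, diagonal_transpose, diagonal_transpose, Matrix.mul_neg,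
    Matrix.add_mul, Matrix.mul_add, Matrix.neg_mul, Matrix.mul_add, e1,
    Matrix.mul_assoc (diagonal q),
    Matrix.mul_assoc (diagonal q), e2]
  simp only [Matrix.mul_neg, diagonal_mul_diagonal, neg_add, neg_neg]
  rw [add_assoc, add_neg_cancel_left, diagonal_add]
  congr 1
  funext j
  ring

theorem norm_sq_diagonal_add_mul {A : Matrix (Fin d) (Fin d) ℝ} (hA : Aᵀ = -A)
    {β : Fin d → ℝ} (h : A * A = -diagonal β) {p q : Fin d → ℝ}
    (hp : ∀ i j, β i = β j → p i = p j) (hq : ∀ i j, β i = β j → q i = q j)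
    (X : Matrix (Fin d) (Fin r) ℝ) :
    ‖(diagonal p + A * diagonal q) * X‖ ^ 2
      = ∑ j, (p j ^ 2 + β j * q j ^ 2) * ∑ b, X j b ^ 2 := by
  rw [norm_sq_eq_inn, inn_mul_left, ← Matrix.mul_assoc, transpose_mul_self_diagonal_add hA h hp hq,
    inn_eq_sum]
  simp only [diagonal_mul, Finset.mul_sum]
  refine Finset.sum_congr rfl fun j _ => Finset.sum_congr rfl fun b _ => ?_
  ring

theorem hasDerivAt_diagonal_add_mul (A : Matrix (Fin d) (Fin d) ℝ) {p q : ℝ → Fin d → ℝ}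
    {p' q' : Fin d → ℝ} {t : ℝ} (hp : ∀ j, HasDerivAt (fun t => p t j) (p' j) t)
    (hq : ∀ j, HasDerivAt (fun t => q t j) (q' j) t) (X : Matrix (Fin d) (Fin r) ℝ) :
    HasDerivAt (fun t => (diagonal (p t) + A * diagonal (q t)) * X)
      ((diagonal p' + A * diagonal q') * X) t := by
  let T : ((Fin d → ℝ) × (Fin d → ℝ)) →ₗ[ℝ] Matrix (Fin d) (Fin r) ℝ :=
    { toFun := fun v => (diagonal v.1 + A * diagonal v.2) * X
      map_add' := fun v w => by
        simp only [Prod.fst_add, Prod.snd_add]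
        rw [show diagonal (v.1 + w.1) = diagonal v.1 + diagonal w.1 from (diagonal_add _ _).symm,
          show diagonal (v.2 + w.2) = diagonal v.2 + diagonal w.2 from (diagonal_add _ _).symm,
          Matrix.mul_add, ← Matrix.add_mul]
        congr 1
        abel
      map_smul' := fun c v => by
        simp only [Prod.smul_fst, Prod.smul_snd, diagonal_smul, RingHom.id_apply,
          Matrix.mul_smul, ← smul_add, Matrix.smul_mul] }
  exact (LinearMap.toContinuousLinearMap T).hasFDerivAt.comp_hasDerivAt t
    ((hasDerivAt_pi.2 hp).prodMk (hasDerivAt_pi.2 hq))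

/-- The curve is `(cos (tφ) + A sin (tφ)/√β) X`, a rotation with angles `φ = 2 arctan √β` that
reaches the Cayley transform at `t = 1`. Row `j` of `X` contributes to the squared speed, squared
distance and squared chord with the factors `φ²`, `4 sin² (tφ/2)` and `4 sin² (φ/2)`, so both
estimates reduce to scalar inequalities in `φ/2 ∈ [0, π/2]`. -/
theorem hasShortPath_of_sq_eq_diagonal {A : Matrix (Fin d) (Fin d) ℝ} (hA : Aᵀ = -A)
    {β : Fin d → ℝ} (hβ : ∀ j, 0 ≤ β j) (h : A * A = -diagonal β)
    {X Y : Matrix (Fin d) (Fin r) ℝ} (hX : X ∈ stiefel d r) (hXY : (1 - A) * Y = (1 + A) * X) :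
    HasShortPath X Y := by
  have hpi := Real.pi_pos
  let φ : ℝ → ℝ := fun b => 2 * Real.arctan √b
  -- At `b = 0` the quotient takes its limit `2 t`, since `2 arctan √b / √b → 2`.
  let sn : ℝ → ℝ → ℝ := fun t b => if b = 0 then 2 * t else Real.sin (t * φ b) / √b
  let sn' : ℝ → ℝ → ℝ := fun t b => if b = 0 then 2 else φ b * Real.cos (t * φ b) / √b
  have hφ0 : φ 0 = 0 := by simp [φ]
  have hφnn : ∀ b, 0 ≤ φ b / 2 := fun b => by
    have : 0 ≤ Real.arctan √b := Real.arctan_nonneg.2 (Real.sqrt_nonneg b)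
    simp only [φ]
    linarith
  have hφle : ∀ b, φ b / 2 ≤ Real.pi / 2 := fun b => by
    have := (Real.arctan_lt_pi_div_two √b).le
    simp only [φ]
    linarith
  have hsq : ∀ {b : ℝ} (s : ℝ), 0 ≤ b → b ≠ 0 → b * (s / √b) ^ 2 = s ^ 2 := by
    intro b s hb hb0
    rw [div_pow, Real.sq_sqrt hb]
    field_simp
  have hN : ∀ t b, 0 ≤ b → Real.cos (t * φ b) ^ 2 + b * sn t b ^ 2 = 1 := by
    intro t b hb
    by_cases hb0 : b = 0
    · simp [hb0, hφ0]
    · simp only [sn, if_neg hb0]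
      rw [hsq _ hb hb0, Real.cos_sq_add_sin_sq]
  have hN' : ∀ t b, 0 ≤ b → (-(φ b * Real.sin (t * φ b))) ^ 2 + b * sn' t b ^ 2 = φ b ^ 2 := by
    intro t b hb
    by_cases hb0 : b = 0
    · simp [hb0, hφ0]
    · simp only [sn', if_neg hb0]
      rw [hsq _ hb hb0]
      linear_combination φ b ^ 2 * Real.sin_sq_add_cos_sq (t * φ b)
  have hD : ∀ t b, 0 ≤ b →
      (Real.cos (t * φ b) - 1) ^ 2 + b * sn t b ^ 2 = 4 * Real.sin (t * (φ b / 2)) ^ 2 := by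
    intro t b hb
    have h1 := hN t b hb
    have h2 : Real.cos (t * φ b) = 1 - 2 * Real.sin (t * (φ b / 2)) ^ 2 := by
      rw [show t * φ b = 2 * (t * (φ b / 2)) by ring, Real.cos_two_mul, Real.cos_sq']
      ring
    linear_combination h1 - 2 * h2
  have hcos : ∀ b, 0 ≤ b → Real.cos (φ b) = (1 - b) / (1 + b) := by
    intro b hb
    simp only [φ]
    rw [Real.cos_two_mul, Real.cos_sq_arctan, Real.sq_sqrt hb]
    field_simp
    ring
  have hsn1 : ∀ b, 0 ≤ b → sn 1 b = 2 / (1 + b) := by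
    intro b hb
    by_cases hb0 : b = 0
    · simp [sn, hb0]
    · simp only [sn, if_neg hb0, one_mul, φ]
      rw [Real.sin_two_mul, mul_assoc, Real.sin_arctan, Real.cos_arctan]
      have h1 : √b ≠ 0 := (Real.sqrt_pos.2 (lt_of_le_of_ne hb (Ne.symm hb0))).ne'
      rw [Real.sq_sqrt hb]
      have h2 : √(1 + b) * √(1 + b) = 1 + b := Real.mul_self_sqrt (by linarith)
      have h3 : √(1 + b) ≠ 0 := (Real.sqrt_pos.2 (by linarith)).ne'
      rw [div_mul_div_comm, h2]
      field_simp
  set γ : ℝ → Matrix (Fin d) (Fin r) ℝ := fun t =>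
    (diagonal (fun j => Real.cos (t * φ (β j))) + A * diagonal fun j => sn t (β j)) * X with hγ
  set γ' : ℝ → Matrix (Fin d) (Fin r) ℝ := fun t =>
    (diagonal (fun j => -(φ (β j) * Real.sin (t * φ (β j))))
      + A * diagonal fun j => sn' t (β j)) * X with hγ'
  have hcg : ∀ g : ℝ → ℝ, ∀ i j, β i = β j → g (β i) = g (β j) := fun g i j e => congrArg g e
  have h0 : γ 0 = X := by
    have : (fun j => sn 0 (β j)) = 0 := by
      funext j
      simp [sn]
    simp [hγ, this]
  have h1 : γ 1 = Y := by
    -- The endpoint is identified through `cos φ = (1 - β)/(1 + β)` and `sin φ / √β = 2/(1 + β)`: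
    -- these give `cos φ + β sn = 1` and `sn - cos φ = 1`, which is the Cayley relation.
    refine eq_of_one_sub_skew_mul_eq hA (hXY ▸ ?_)
    rw [hγ]
    simp only
    rw [← Matrix.mul_assoc]
    congr 1
    rw [Matrix.sub_mul, Matrix.one_mul, Matrix.mul_add, ← Matrix.mul_assoc A A, h, Matrix.neg_mul,
      diagonal_mul_diagonal]
    have e1 : (diagonal fun j => Real.cos (1 * φ (β j)))
        = 1 - diagonal fun j => β j * sn 1 (β j) := by
      rw [← diagonal_one, diagonal_sub]
      congr 1
      funext j
      have : 1 + β j ≠ 0 := by linarith [hβ j]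
      rw [one_mul, hcos _ (hβ j), hsn1 _ (hβ j)]
      field_simp
      ring
    have e2 : (diagonal fun j => sn 1 (β j))
        = 1 + diagonal fun j => Real.cos (1 * φ (β j)) := by
      rw [← diagonal_one, diagonal_add]
      congr 1
      funext j
      have : 1 + β j ≠ 0 := by linarith [hβ j]
      rw [one_mul, hcos _ (hβ j), hsn1 _ (hβ j)]
      field_simp
      ring
    rw [e2, Matrix.mul_add, Matrix.mul_one]
    nth_rewrite 1 [e1]
    abel
  have hnorm : ∀ t, ‖γ t - X‖ ^ 2
      = ∑ j, (4 * Real.sin (t * (φ (β j) / 2)) ^ 2) * ∑ b, X j b ^ 2 := by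
    intro t
    have e : γ t - X = (diagonal (fun j => Real.cos (t * φ (β j)) - 1)
        + A * diagonal fun j => sn t (β j)) * X := by
      have : (diagonal fun j => Real.cos (t * φ (β j)) - 1)
          = (diagonal fun j => Real.cos (t * φ (β j))) - 1 := by
        rw [← diagonal_one, diagonal_sub]
      rw [this, hγ]
      simp only [Matrix.add_mul, Matrix.sub_mul, Matrix.one_mul]
      abel
    rw [e, norm_sq_diagonal_add_mul hA h (hcg fun b => Real.cos (t * φ b) - 1) (hcg (sn t))]
    refine Finset.sum_congr rfl fun j _ => ?_
    rw [hD t _ (hβ j)]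
  have hchord : ‖Y - X‖ ^ 2 = ∑ j, (4 * Real.sin (φ (β j) / 2) ^ 2) * ∑ b, X j b ^ 2 := by
    rw [← h1, hnorm 1]
    simp
  refine ⟨γ, γ', h0, h1, fun t => hasDerivAt_diagonal_add_mul A (fun j => ?_) (fun j => ?_) X,
    fun t => ?_, fun t => ?_, fun t ht => ?_⟩
  · have := ((hasDerivAt_id t).mul_const (φ (β j))).cos
    convert! this using 1
    simp
    ring
  · by_cases hb0 : β j = 0
    · simp only [sn, sn', if_pos hb0]
      simpa using (hasDerivAt_id t).const_mul (2 : ℝ)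
    · simp only [sn, sn', if_neg hb0]
      have := (((hasDerivAt_id t).mul_const (φ (β j))).sin).div_const √(β j)
      convert! this using 1
      simp
      ring
  · change (γ t)ᵀ * γ t = 1
    rw [hγ]
    simp only
    rw [transpose_mul, Matrix.mul_assoc, ← Matrix.mul_assoc _ _ X,
      transpose_mul_self_diagonal_add hA h (hcg fun b => Real.cos (t * φ b)) (hcg (sn t))]
    have : (fun j => Real.cos (t * φ (β j)) ^ 2 + β j * sn t (β j) ^ 2) = fun _ => 1 := by
      funext j
      exact hN t _ (hβ j)
    rw [this, diagonal_one, Matrix.one_mul]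
    exact hX
  · refine le_of_sq_le_sq ?_ (by positivity)
    rw [hγ']
    simp only
    rw [norm_sq_diagonal_add_mul hA h (hcg fun b => -(φ b * Real.sin (t * φ b))) (hcg (sn' t)),
      mul_pow, hchord, Finset.mul_sum]
    refine Finset.sum_le_sum fun j _ => ?_
    rw [hN' t _ (hβ j), ← mul_assoc]
    refine mul_le_mul_of_nonneg_right ?_ (Finset.sum_nonneg fun b _ => sq_nonneg _)
    -- Jordan's inequality at `φ/2` gives `φ ≤ π sin (φ/2)`, the source of the factor `π/2` in the
    -- speed bound.
    have h3 := Real.mul_le_sin (hφnn (β j)) (hφle (β j))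
    have h4 : φ (β j) ≤ Real.pi * Real.sin (φ (β j) / 2) := by
      have := mul_le_mul_of_nonneg_left h3 hpi.le
      refine le_of_eq_of_le ?_ this
      field_simp
    calc φ (β j) ^ 2 ≤ (Real.pi * Real.sin (φ (β j) / 2)) ^ 2 := by
          refine pow_le_pow_left₀ ?_ h4 2
          linarith [hφnn (β j)]
      _ = _ := by ring
  · have hs : 0 ≤ Real.sin (Real.pi * t / 2) := Real.sin_nonneg_of_nonneg_of_le_pi
      (by nlinarith [ht.1]) (by nlinarith [ht.2])
    refine le_of_sq_le_sq ?_ (by positivity)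
    rw [hnorm, mul_pow, hchord, Finset.mul_sum]
    refine Finset.sum_le_sum fun j _ => ?_
    rw [← mul_assoc]
    refine mul_le_mul_of_nonneg_right ?_ (Finset.sum_nonneg fun b _ => sq_nonneg _)
    have h3 := sin_mul_le_sin_mul_sin ht.1 ht.2 (hφnn (β j)) (hφle (β j))
    have h4 : 0 ≤ Real.sin (t * (φ (β j) / 2)) := Real.sin_nonneg_of_nonneg_of_le_pi
      (mul_nonneg ht.1 (hφnn _)) (by nlinarith [ht.1, ht.2, hφle (β j), hφnn (β j)])
    have := pow_le_pow_left₀ h4 h3 2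
    rw [mul_pow] at this
    linarith

/-- Left multiplication by an orthogonal matrix preserves the manifold, the norms and the Cayley
relation. An orthogonal eigenbasis of `AᵀA = -A²` therefore reduces to the diagonal case. -/
theorem hasShortPath_of_cayley {A : Matrix (Fin d) (Fin d) ℝ} (hA : Aᵀ = -A)
    {X Y : Matrix (Fin d) (Fin r) ℝ} (hX : X ∈ stiefel d r) (hXY : (1 - A) * Y = (1 + A) * X) :
    HasShortPath X Y := by
  have hH : (Aᵀ * A).IsHermitian := by
    rw [Matrix.IsHermitian, conjTranspose_eq_transpose_of_trivial, transpose_mul,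
      transpose_transpose]
  set V : Matrix (Fin d) (Fin d) ℝ := (hH.eigenvectorUnitary : Matrix (Fin d) (Fin d) ℝ) with hV
  have hVV : Vᵀ * V = 1 := by
    have := Unitary.coe_star_mul_self hH.eigenvectorUnitary
    rwa [star_eq_conjTranspose, conjTranspose_eq_transpose_of_trivial] at this
  have hVV' : V * Vᵀ = 1 := mul_eq_one_comm.1 hVV
  set β := hH.eigenvalues with hβ
  have hspec : Aᵀ * A = V * diagonal β * Vᵀ := by
    have := hH.spectral_theorem
    rw [Unitary.conjStarAlgAut_apply] at this
    simpa [star_eq_conjTranspose] using! this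
  have hsq : (Vᵀ * A * V) * (Vᵀ * A * V) = -diagonal β := by
    have h1 : A * A = -(V * diagonal β * Vᵀ) := by rw [← hspec, hA, Matrix.neg_mul, neg_neg]
    calc (Vᵀ * A * V) * (Vᵀ * A * V) = Vᵀ * A * (V * Vᵀ) * A * V := by
          simp only [Matrix.mul_assoc]
      _ = Vᵀ * (A * A) * V := by rw [hVV', Matrix.mul_one]; simp only [Matrix.mul_assoc]
      _ = -((Vᵀ * V) * diagonal β * (Vᵀ * V)) := by
          rw [h1]
          simp only [Matrix.mul_assoc, Matrix.mul_neg, Matrix.neg_mul]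
      _ = -diagonal β := by rw [hVV, Matrix.one_mul, Matrix.mul_one]
  have hskew : (Vᵀ * A * V)ᵀ = -(Vᵀ * A * V) := by
    simp only [transpose_mul, transpose_transpose, hA, Matrix.neg_mul, Matrix.mul_neg,
      Matrix.mul_assoc]
  have hnorm : ∀ (U : Matrix (Fin d) (Fin d) ℝ), Uᵀ * U = 1 → ∀ W : Matrix (Fin d) (Fin r) ℝ,
      ‖U * W‖ = ‖W‖ := by
    intro U hU W
    have : ‖U * W‖ ^ 2 = ‖W‖ ^ 2 := by
      rw [norm_sq_eq_inn, inn_mul_left, ← Matrix.mul_assoc, hU, Matrix.one_mul, norm_sq_eq_inn]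
    exact (sq_eq_sq₀ (norm_nonneg _) (norm_nonneg _)).1 this
  have hmem : ∀ (U : Matrix (Fin d) (Fin d) ℝ), Uᵀ * U = 1 → ∀ W ∈ stiefel d r,
      U * W ∈ stiefel d r := by
    intro U hU W hW
    change (U * W)ᵀ * (U * W) = 1
    rw [transpose_mul, Matrix.mul_assoc, ← Matrix.mul_assoc Uᵀ, hU, Matrix.one_mul]
    exact hW
  have hVT : Vᵀᵀ * Vᵀ = 1 := by rw [transpose_transpose, hVV']
  obtain ⟨γ, γ', h0, h1, hd, hst, hsp, hdi⟩ := hasShortPath_of_sq_eq_diagonal hskew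
    (fun j => (show (Aᵀ * A).PosSemidef by
      simpa using Matrix.posSemidef_conjTranspose_mul_self A).eigenvalues_nonneg j) hsq
    (hmem _ hVT X hX) (Y := Vᵀ * Y) (by
      have e : Vᵀ * A * V * (Vᵀ * Y) = Vᵀ * (A * Y) := by
        rw [← Matrix.mul_assoc, Matrix.mul_assoc _ V, hVV', Matrix.mul_one, Matrix.mul_assoc]
      have e' : Vᵀ * A * V * (Vᵀ * X) = Vᵀ * (A * X) := by
        rw [← Matrix.mul_assoc, Matrix.mul_assoc _ V, hVV', Matrix.mul_one, Matrix.mul_assoc]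
      rw [Matrix.sub_mul, Matrix.add_mul, e, e', Matrix.one_mul, Matrix.one_mul,
        ← Matrix.mul_sub, ← Matrix.mul_add]
      congr 1
      simpa [Matrix.sub_mul, Matrix.add_mul] using hXY)
  have hback : ∀ W : Matrix (Fin d) (Fin r) ℝ, V * (Vᵀ * W) = W := fun W => by
    rw [← Matrix.mul_assoc, hVV', Matrix.one_mul]
  rw [← Matrix.mul_sub, hnorm _ hVT] at hsp hdi
  refine ⟨fun t => V * γ t, fun t => V * γ' t, ?_, ?_, fun t => ?_, fun t => hmem V hVV _ (hst t),
    fun t => ?_, fun t ht => ?_⟩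
  · simp only [h0, hback]
  · simp only [h1, hback]
  · exact (LinearMap.toContinuousLinearMap
      (mulLeftLinearMap (Fin r) ℝ V)).hasFDerivAt.comp_hasDerivAt t (hd t)
  · rw [hnorm V hVV]
    exact hsp t
  · have := hdi t ht
    rwa [← hnorm V hVV, Matrix.mul_sub, hback] at this

end ShortPath

/-! ### The descent inequality on the manifold. -/

section Descent

variable {d r : ℕ}

/-- `f` is differentiable on the Stiefel manifold, with `L`-Lipschitz Euclidean gradient there. -/
structure SmoothOnStiefel (f : Matrix (Fin d) (Fin r) ℝ → ℝ) (L : ℝ) : Prop where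
  differentiableAt : ∀ X ∈ stiefel d r, DifferentiableAt ℝ f X
  lipschitz : ∀ X ∈ stiefel d r, ∀ Y ∈ stiefel d r, ‖euclGrad f X - euclGrad f Y‖ ≤ L * ‖X - Y‖

/-- `inn G` as a continuous linear map. -/
noncomputable def innCLM (G : Matrix (Fin d) (Fin r) ℝ) : Matrix (Fin d) (Fin r) ℝ →L[ℝ] ℝ :=
  LinearMap.toContinuousLinearMap
    { toFun := inn G
      map_add' := inn_add_right G
      map_smul' := fun c X => inn_smul_right c G X }

theorem SmoothOnStiefel.le_of_hasShortPath {f : Matrix (Fin d) (Fin r) ℝ → ℝ} {L : ℝ}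
    (hf : SmoothOnStiefel f L) (hL : 0 ≤ L) {X Y : Matrix (Fin d) (Fin r) ℝ}
    (hX : X ∈ stiefel d r) (h : HasShortPath X Y) :
    f Y ≤ f X + inn (euclGrad f X) (Y - X) + L * ‖Y - X‖ ^ 2 := by
  obtain ⟨γ, γ', h0, h1, hd, hst, hsp, hdi⟩ := h
  have hpi := Real.pi_pos
  set u := ‖Y - X‖ with hu
  set G := euclGrad f X with hG
  -- Comparison function: `1 - cos (π t/2)` has derivative `(π/2) sin (π t/2)`, the product of the
  -- distance and speed factors of the path. It rises from `0` to `1`, so the remainder is exactly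
  -- `L u²`.
  have hderiv : ∀ t, HasDerivAt
      (fun t => f (γ t) - inn G (γ t) - L * u ^ 2 * (1 - Real.cos (Real.pi * t / 2)))
      (inn (euclGrad f (γ t) - G) (γ' t)
        - L * u ^ 2 * (Real.sin (Real.pi * t / 2) * (Real.pi / 2))) t := by
    intro t
    have e1 : HasDerivAt (fun t => f (γ t)) (inn (euclGrad f (γ t)) (γ' t)) t := by
      rw [← fderiv_eq_inn_euclGrad]
      exact (hf.differentiableAt _ (hst t)).hasFDerivAt.comp_hasDerivAt t (hd t)
    have e2 : HasDerivAt (fun t => inn G (γ t)) (inn G (γ' t)) t :=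
      (innCLM G).hasFDerivAt.comp_hasDerivAt t (hd t)
    have e3 : HasDerivAt (fun t : ℝ => Real.pi * t / 2) (Real.pi / 2) t := by
      simpa using ((hasDerivAt_id t).const_mul Real.pi).div_const 2
    convert! (e1.sub e2).sub ((e3.cos.const_sub 1).const_mul (L * u ^ 2)) using 1
    rw [inn_sub_left]
    ring
  have hanti : AntitoneOn
      (fun t => f (γ t) - inn G (γ t) - L * u ^ 2 * (1 - Real.cos (Real.pi * t / 2)))
      (Set.Icc 0 1) := by
    refine antitoneOn_of_deriv_nonpos (convex_Icc _ _)
      (fun t _ => (hderiv t).continuousAt.continuousWithinAt)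
      (fun t _ => (hderiv t).differentiableAt.differentiableWithinAt) fun t ht => ?_
    rw [(hderiv t).deriv, sub_nonpos]
    have ht' := interior_subset ht
    calc inn (euclGrad f (γ t) - G) (γ' t) ≤ ‖euclGrad f (γ t) - G‖ * ‖γ' t‖ := inn_le _ _
      _ ≤ (L * (Real.sin (Real.pi * t / 2) * u)) * (Real.pi / 2 * u) := by
          gcongr
          · have := hdi t ht'
            have h2 : 0 ≤ ‖γ t - X‖ := norm_nonneg _
            exact mul_nonneg hL (h2.trans this)
          · exact (hf.lipschitz _ (hst t) _ hX).trans
              (mul_le_mul_of_nonneg_left (hdi t ht') hL)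
          · exact hsp t
      _ = _ := by ring
  have := hanti (Set.left_mem_Icc.2 zero_le_one) (Set.right_mem_Icc.2 zero_le_one) zero_le_one
  simp only [h0, h1, mul_one, mul_zero, zero_div, Real.cos_zero, Real.cos_pi_div_two, sub_self,
    sub_zero] at this
  rw [inn_sub_right]
  linarith

/-- `Y` is reached from `X` along an analytic curve of orthogonal transformations. -/
def AnalyticallyReachable (X Y : Matrix (Fin d) (Fin r) ℝ) : Prop :=
  ∃ Q : ℝ → Matrix (Fin d) (Fin d) ℝ, AnalyticOnNhd ℝ Q Set.univ ∧ (∀ s, (Q s)ᵀ * Q s = 1) ∧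
    Q 0 = 1 ∧ Q 1 * X = Y

theorem AnalyticallyReachable.refl (X : Matrix (Fin d) (Fin r) ℝ) : AnalyticallyReachable X X :=
  ⟨fun _ => 1, analyticOnNhd_const, fun _ => by simp, rfl, by simp⟩

theorem mul_mem_stiefel {Q : Matrix (Fin d) (Fin d) ℝ} (hQ : Qᵀ * Q = 1)
    {X : Matrix (Fin d) (Fin r) ℝ} (hX : X ∈ stiefel d r) : Q * X ∈ stiefel d r := by
  change (Q * X)ᵀ * (Q * X) = 1
  rw [transpose_mul, Matrix.mul_assoc, ← Matrix.mul_assoc Qᵀ, hQ, Matrix.one_mul]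
  exact hX

/-- The Cayley transform of `s • A` is orthogonal and analytic in `s`, equals the identity at `s =
0`, and at `s = 1` carries `Y` to `Y'`. Multiplying it onto the given curve keeps all properties. -/
theorem AnalyticallyReachable.step {X Y Y' : Matrix (Fin d) (Fin r) ℝ} (hY : Y ∈ stiefel d r)
    (hY' : Y' ∈ stiefel d r) (h : AnalyticallyReachable X Y) (hlt : ‖Y' - Y‖ < 2) :
    AnalyticallyReachable X Y' := by
  obtain ⟨Q, hQ, hQo, hQ0, hQ1⟩ := h
  obtain ⟨A, hA, hAY⟩ := exists_skew_of_isUnit hY hY' (isUnit_add_of_norm_sub_lt hY hY' hlt)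
  have hskew : ∀ s : ℝ, (s • A)ᵀ = -(s • A) := fun s => by rw [transpose_smul, hA, smul_neg]
  have hunit : ∀ s : ℝ, IsUnit (1 - s • A) := fun s => isUnit_one_sub_skew (hskew s)
  set R : ℝ → Matrix (Fin d) (Fin d) ℝ := fun s => Ring.inverse (1 - s • A) * (1 + s • A) with hR
  have hRmul : ∀ s, (1 - s • A) * R s = (1 + s • A) * 1 := fun s => by
    rw [hR]
    simp only
    rw [← Matrix.mul_assoc, Ring.mul_inverse_cancel _ (hunit s), Matrix.one_mul, Matrix.mul_one]
  have hRo : ∀ s, (R s)ᵀ * R s = 1 := fun s => by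
    rw [transpose_mul_self_eq_of_cayley (hskew s) (hRmul s)]
    simp
  have hlin : AnalyticOnNhd ℝ (fun s : ℝ => s • A) Set.univ := fun s _ =>
    analyticAt_id.smul analyticAt_const
  have hRa : AnalyticOnNhd ℝ R Set.univ := fun s _ => by
    refine AnalyticAt.mul ?_ (analyticAt_const.add (hlin s trivial))
    have h1 : AnalyticAt ℝ (fun s : ℝ => 1 - s • A) s := analyticAt_const.sub (hlin s trivial)
    obtain ⟨u, hu⟩ := hunit s
    have h2 : AnalyticAt ℝ Ring.inverse ((fun s : ℝ => 1 - s • A) s) := by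
      simp only
      rw [← hu]
      exact analyticAt_inverse u
    exact AnalyticAt.comp (g := Ring.inverse) (f := fun s : ℝ => 1 - s • A) h2 h1
  refine ⟨fun s => R s * Q s, fun s _ => (hRa s trivial).mul (hQ s trivial), fun s => ?_, ?_, ?_⟩
  · rw [transpose_mul, Matrix.mul_assoc, ← Matrix.mul_assoc _ (R s), hRo, Matrix.one_mul, hQo]
  · simp [hR, hQ0]
  · rw [Matrix.mul_assoc, hQ1]
    refine eq_of_one_sub_skew_mul_eq (hskew 1) ?_
    rw [← Matrix.mul_assoc, hRmul, Matrix.mul_one, one_smul, hAY]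

/-- The rank condition needed for a Cayley representation may fail at the endpoint itself, but it
holds at nearby points of an analytic curve. -/
theorem SmoothOnStiefel.le_of_reachable {f : Matrix (Fin d) (Fin r) ℝ → ℝ} {L : ℝ}
    (hf : SmoothOnStiefel f L) (hL : 0 ≤ L) {X Y : Matrix (Fin d) (Fin r) ℝ}
    (hX : X ∈ stiefel d r) (h : AnalyticallyReachable X Y) :
    f Y ≤ f X + inn (euclGrad f X) (Y - X) + L * ‖Y - X‖ ^ 2 := by
  obtain ⟨Q, hQ, hQo, hQ0, hQ1⟩ := h
  have hX' : Xᵀ * X = 1 := hX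
  have hmem : ∀ s, Q s * X ∈ stiefel d r := fun s => mul_mem_stiefel (hQo s) hX
  set p : ℝ → ℝ := fun s => ((X + Q s * X)ᵀ * (X + Q s * X)).det with hp
  have hentry : ∀ i j, AnalyticOnNhd ℝ (fun s => ((X + Q s * X)ᵀ * (X + Q s * X)) i j)
      Set.univ := by
    intro i j s _
    let T : Matrix (Fin d) (Fin d) ℝ →ₗ[ℝ] ℝ :=
      { toFun := fun M => (Xᵀ * (M * X)) i j + (Xᵀ * (M * X)) j i
        map_add' := fun M N => by
          simp only [Matrix.add_mul, Matrix.mul_add, Matrix.add_apply]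
          ring
        map_smul' := fun c M => by
          simp only [Matrix.smul_mul, Matrix.mul_smul, Matrix.smul_apply, smul_eq_mul,
            RingHom.id_apply]
          ring }
    have e : (fun s => ((X + Q s * X)ᵀ * (X + Q s * X)) i j) = fun s =>
        2 * (1 : Matrix (Fin r) (Fin r) ℝ) i j + LinearMap.toContinuousLinearMap T (Q s) := by
      funext s
      have h1 : (X + Q s * X)ᵀ * (X + Q s * X)
          = 1 + 1 + (Xᵀ * (Q s * X) + (Xᵀ * (Q s * X))ᵀ) := by
        have h2 : (Q s * X)ᵀ * (Q s * X) = 1 := hmem s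
        rw [transpose_add, Matrix.add_mul, Matrix.mul_add, Matrix.mul_add, hX', h2,
          transpose_mul Xᵀ, transpose_transpose]
        abel
      rw [h1]
      simp only [Matrix.add_apply, transpose_apply]
      change _ = _ + ((Xᵀ * (Q s * X)) i j + (Xᵀ * (Q s * X)) j i)
      ring
    rw [e]
    exact analyticAt_const.add
      ((ContinuousLinearMap.analyticAt _ _).comp (hQ s trivial))
  have hpa : AnalyticOnNhd ℝ p Set.univ := by
    intro s _
    simp only [hp, det_apply']
    refine Finset.analyticAt_fun_sum _ fun σ _ => analyticAt_const.mul ?_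
    exact Finset.analyticAt_fun_prod _ fun i _ => hentry _ _ s trivial
  -- If the zeros of `p` accumulated at `1`, then `p` would vanish identically, but `p 0 = det
  -- ((2X)ᵀ(2X)) ≠ 0`.
  have hne : ∀ᶠ s in nhdsWithin (1 : ℝ) {1}ᶜ, p s ≠ 0 := by
    by_contra hcon
    rw [Filter.not_eventually] at hcon
    have h0 := hpa.eqOn_zero_of_preconnected_of_frequently_eq_zero isPreconnected_univ
      (Set.mem_univ 1) (hcon.mono fun s hs => not_not.1 hs) (Set.mem_univ 0)
    have h1 : IsUnit ((X + X)ᵀ * (X + X)) := isUnit_add_of_norm_sub_lt hX hX (by simp)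
    rw [Matrix.isUnit_iff_isUnit_det] at h1
    simp only [hp, hQ0, Matrix.one_mul] at h0
    rw [h0] at h1
    simp at h1
  have hQX : ContinuousAt (fun s => Q s * X) 1 := by
    have : Continuous fun M : Matrix (Fin d) (Fin d) ℝ => M * X :=
      continuous_id.matrix_mul continuous_const
    exact this.continuousAt.comp (hQ 1 trivial).continuousAt
  have hfc : ContinuousAt f (Q 1 * X) := (hf.differentiableAt _ (hmem 1)).continuousAt
  have hlim1 : ContinuousAt (fun s => f (Q s * X)) 1 := ContinuousAt.comp (g := f) hfc hQX
  have hlim2 : ContinuousAt (fun s => f X + inn (euclGrad f X) (Q s * X - X)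
      + L * ‖Q s * X - X‖ ^ 2) 1 := by
    have h1 : ContinuousAt (fun s => Q s * X - X) 1 := hQX.sub continuousAt_const
    have h2 : ContinuousAt (fun s => inn (euclGrad f X) (Q s * X - X)) 1 :=
      (innCLM (euclGrad f X)).continuous.continuousAt.comp h1
    exact (continuousAt_const.add h2).add (continuousAt_const.mul (h1.norm.pow 2))
  rw [← hQ1]
  -- The inequality holds at `Q s * X` for `s ≠ 1` near `1`, and both sides are continuous at `s =
  -- 1`.
  refine le_of_tendsto_of_tendsto (hlim1.tendsto.mono_left nhdsWithin_le_nhds)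
    (hlim2.tendsto.mono_left nhdsWithin_le_nhds) (hne.mono fun s hs => ?_)
  obtain ⟨A, hA, hAY⟩ := exists_skew_of_isUnit hX (hmem s)
    ((Matrix.isUnit_iff_isUnit_det _).2 (isUnit_iff_ne_zero.2 hs))
  exact hf.le_of_hasShortPath hL hX (hasShortPath_of_cayley hA hX hAY)

/-- The curve `t ↦ R(X, tE)` is merely smooth, so it is not used directly. By continuity and
connectedness of `ℝ`, its points are linked by chords shorter than `2`, each of which is one Cayley
step. -/
theorem IsRetraction.reachable {ρ : ℝ}
    {R : Matrix (Fin d) (Fin r) ℝ → Matrix (Fin d) (Fin r) ℝ → Matrix (Fin d) (Fin r) ℝ}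
    (hR : IsRetraction ρ R) {X E : Matrix (Fin d) (Fin r) ℝ} (hX : X ∈ stiefel d r)
    (hE : ∀ t : ℝ, t • E ∈ tangent ρ X) : AnalyticallyReachable X (R X E) := by
  have hmem : ∀ t : ℝ, R X (t • E) ∈ stiefel d r := fun t => hR.mapsTo X hX _ (hE t)
  have hc : Continuous fun t : ℝ => R X (t • E) :=
    (hR.smooth X hX).continuousOn.comp_continuous (continuous_id.smul continuous_const) hE
  have key : ∀ a b : ℝ, AnalyticallyReachable X (R X (a • E)) →
      AnalyticallyReachable X (R X (b • E)) := by
    intro a b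
    refine isPreconnected_univ.induction₂' (fun a b => AnalyticallyReachable X (R X (a • E)) →
      AnalyticallyReachable X (R X (b • E))) (fun s _ => ?_)
      (fun _ _ _ _ _ _ h1 h2 h => h2 (h1 h)) (Set.mem_univ a) (Set.mem_univ b)
    rw [nhdsWithin_univ]
    have : ∀ᶠ t in nhds s, dist (R X (t • E)) (R X (s • E)) < 2 :=
      hc.continuousAt.eventually (Metric.ball_mem_nhds _ two_pos)
    filter_upwards [this] with t ht
    rw [dist_eq_norm] at ht
    exact ⟨fun h => h.step (hmem s) (hmem t) ht,
      fun h => h.step (hmem t) (hmem s) (by rwa [norm_sub_rev])⟩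
  have := key 0 1 (by rw [zero_smul, hR.map_zero X hX]; exact .refl X)
  rwa [one_smul] at this

theorem SmoothOnStiefel.retraction_le {f : Matrix (Fin d) (Fin r) ℝ → ℝ} {L ρ L₁ L₂ C : ℝ}
    (hf : SmoothOnStiefel f L) (hL : 0 ≤ L)
    {R : Matrix (Fin d) (Fin r) ℝ → Matrix (Fin d) (Fin r) ℝ → Matrix (Fin d) (Fin r) ℝ}
    (hR : IsRetraction ρ R) (hc : RetractionConstants ρ R L₁ L₂)
    {X E : Matrix (Fin d) (Fin r) ℝ} (hX : X ∈ stiefel d r) (hC : ‖euclGrad f X‖ ≤ C)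
    (hE : ∀ t : ℝ, t • E ∈ tangent ρ X) :
    f (R X E) ≤ f X + inn (euclGrad f X) E + (L₂ * C + L₁ ^ 2 * L) * ‖E‖ ^ 2 := by
  have h1 := hf.le_of_reachable hL hX (hR.reachable hX hE)
  obtain ⟨h2, h3⟩ := hc X hX E (by simpa using hE 1) 1 zero_le_one
  simp only [one_smul, mul_one, one_pow] at h2 h3
  have h4 : inn (euclGrad f X) (R X E - X - E) ≤ C * (L₂ * ‖E‖ ^ 2) :=
    (inn_le _ _).trans (mul_le_mul hC h3 (norm_nonneg _) ((norm_nonneg _).trans hC))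
  have h5 : L * ‖R X E - X‖ ^ 2 ≤ L * (L₁ * ‖E‖) ^ 2 := by gcongr
  rw [inn_sub_right] at h4
  linarith

/-- Expanding around `X`, the second-order error of the retraction is paired with `X - Z`, whose
norm is at most the diameter bound `2√r`. This produces the term `4 L₂ √r` of `L̃`. -/
theorem norm_retraction_sub_sq_le {ρ L₁ L₂ : ℝ}
    {R : Matrix (Fin d) (Fin r) ℝ → Matrix (Fin d) (Fin r) ℝ → Matrix (Fin d) (Fin r) ℝ}
    (hc : RetractionConstants ρ R L₁ L₂) {X Z E : Matrix (Fin d) (Fin r) ℝ}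
    (hX : X ∈ stiefel d r) (hZ : Z ∈ stiefel d r) (hE : E ∈ tangent ρ X) :
    ‖R X E - Z‖ ^ 2
      ≤ ‖X - Z‖ ^ 2 + 2 * inn (X - Z) E + (L₁ ^ 2 + 4 * L₂ * √(r : ℝ)) * ‖E‖ ^ 2 := by
  obtain ⟨h2, h3⟩ := hc X hX E hE 1 zero_le_one
  simp only [one_smul, mul_one, one_pow] at h2 h3
  have h4 : inn (X - Z) (R X E - X - E) ≤ (2 * √(r : ℝ)) * (L₂ * ‖E‖ ^ 2) :=
    (inn_le _ _).trans (mul_le_mul (norm_sub_le_of_mem_stiefel hX hZ) h3 (norm_nonneg _)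
      (by positivity))
  have h5 : ‖R X E - X‖ ^ 2 ≤ (L₁ * ‖E‖) ^ 2 := by gcongr
  have h6 : R X E - Z = (X - Z) + (R X E - X) := by abel
  rw [inn_sub_right] at h4
  rw [h6, norm_add_sq_inn]
  linarith

end Descent

/-! ### Parameter estimates within an epoch. -/

namespace Consts

variable {P : Consts}

theorem Valid.one_le_Ltilde (hP : P.Valid) : 1 ≤ P.Ltilde := by
  have h1 : 1 ≤ P.L₁ ^ 2 := one_le_pow₀ hP.one_le_L₁
  have h2 : 0 ≤ 4 * P.L₂ * √(P.r : ℝ) := by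
    have := hP.L₂_pos
    positivity
  unfold Ltilde
  linarith

theorem Valid.Lhat_pos (hP : P.Valid) : 0 < P.Lhat := by
  have := hP.L₂_pos
  have := hP.C_pos
  have := hP.L_pos
  unfold Lhat
  positivity

/-- The factor `√L̃ L / ν` between steps and induced constants. -/
noncomputable def scale (P : Consts) : ℝ := √P.Ltilde * P.L / P.ν

theorem Valid.scale_pos (hP : P.Valid) : 0 < P.scale := by
  have h1 := hP.L_pos
  have h2 := hP.ν_pos
  have h3 : 0 < √P.Ltilde := Real.sqrt_pos.2 (by linarith [hP.one_le_Ltilde])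
  unfold scale
  positivity

theorem Valid.isInduced_iff (hP : P.Valid) (n : ℕ) (κ c : ℝ) :
    P.IsInduced n κ c ↔ ∃ l ∈ Set.Icc P.τmin P.τmax,
      c = l * P.scale * (P.K n κ : ℝ) ^ (P.μ - 1) := by
  have h2 := hP.ν_pos
  have h3 : √P.Ltilde * P.L ≠ 0 := by
    have := hP.scale_pos
    unfold scale at this
    intro h
    simp [h] at this
  have h4 := left_ne_zero_of_mul h3
  have h5 := right_ne_zero_of_mul h3
  constructor
  · rintro ⟨ϱ, hϱ, rfl⟩
    refine ⟨_, hϱ, ?_⟩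
    unfold scale
    field_simp
  · rintro ⟨l, hl, rfl⟩
    refine ⟨l * P.scale, ?_, rfl⟩
    have : l * P.scale * P.ν / (√P.Ltilde * P.L) = l := by
      unfold scale
      field_simp
    rwa [this]

theorem K_pos {n : ℕ} (hn : 0 < n) {κ : ℝ} (hκ : 0 < κ) : 0 < P.K n κ := by
  unfold K
  rw [Nat.ceil_pos]
  positivity

theorem batch_pos {n : ℕ} (hn : 0 < n) {κ : ℝ} (hκ : 0 < κ) : 0 < P.batch n κ := by
  have : (0 : ℝ) < P.K n κ := Nat.cast_pos.2 (K_pos hn hκ)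
  unfold batch
  rw [Nat.ceil_pos]
  positivity

/-- The relative variance contribution `L̃ L² τ² / (ν² b)`. -/
noncomputable def varRate (P : Consts) (n : ℕ) (κ τ : ℝ) : ℝ :=
  P.Ltilde * P.L ^ 2 * τ ^ 2 / (P.ν ^ 2 * P.batch n κ)

/-- The growth rate of the squared distance to the anchor in an inner iteration. -/
noncomputable def growth (P : Consts) (n : ℕ) (κ τ : ℝ) : ℝ :=
  2 * P.β n κ * τ + P.varRate n κ τ

/-- Scalar core, with `x = K^μ`, `c/K = βτ` and `q` the variance rate. The growth `(1 + z)^m` over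
an epoch is at most `exp (K z) ≤ exp (c² + 2c)`. The coefficient in front of the geometric sum is at
most `x z`, so the denominator `z` cancels. -/
theorem bracket_le_of {K : ℕ} {x c q lt : ℝ} (hK : 0 < K) (hx1 : 1 ≤ x) (hxK : x ≤ K)
    (hc : 0 < c) (hq0 : 0 ≤ q) (hq : q ≤ c ^ 2 * x / K ^ 2) (hlt : 1 ≤ lt) {m : ℕ} (hm : m ≤ K) :
    1 + (1 + 2 / (lt * (c / K))) * q * (((1 + (2 * (c / K) + q)) ^ m - 1) / (2 * (c / K) + q))
      ≤ x * Real.exp (c ^ 2 + 2 * c) := by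
  have hK' : (0 : ℝ) < K := Nat.cast_pos.2 hK
  set z := 2 * (c / K) + q with hz
  have hz0 : 0 < z := by positivity
  have hKq : K * q ≤ c ^ 2 := by
    calc K * q ≤ K * (c ^ 2 * x / K ^ 2) := by gcongr
      _ = c ^ 2 * (x / K) := by field_simp
      _ ≤ c ^ 2 * 1 := by
          gcongr
          rwa [div_le_one hK']
      _ = c ^ 2 := mul_one _
  have hpow : (1 + z) ^ m ≤ Real.exp (c ^ 2 + 2 * c) := by
    calc (1 + z) ^ m ≤ (Real.exp z) ^ m := by
          gcongr
          linarith [Real.add_one_le_exp z]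
      _ = Real.exp (m * z) := (Real.exp_nat_mul z m).symm
      _ ≤ Real.exp (c ^ 2 + 2 * c) := by
          refine Real.exp_le_exp.2 ?_
          calc (m : ℝ) * z ≤ K * z := by gcongr
            _ = K * q + 2 * c := by rw [hz]; field_simp; ring
            _ ≤ _ := by linarith
  have h1pow : 1 ≤ (1 + z) ^ m := one_le_pow₀ (by linarith)
  have hcoef : (1 + 2 / (lt * (c / K))) * q ≤ x * z := by
    have h1 : 2 / (lt * (c / K)) ≤ 2 * K / c := by
      rw [show 2 * (K : ℝ) / c = 2 / (1 * (c / K)) by field_simp]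
      gcongr
    calc (1 + 2 / (lt * (c / K))) * q ≤ (1 + 2 * K / c) * q := by gcongr
      _ = q + 2 * K / c * q := by ring
      _ ≤ x * q + 2 * K / c * (c ^ 2 * x / K ^ 2) := by
          gcongr
          exact le_mul_of_one_le_left hq0 hx1
      _ = x * z := by rw [hz]; field_simp; ring
  calc 1 + (1 + 2 / (lt * (c / K))) * q * (((1 + z) ^ m - 1) / z)
      ≤ 1 + x * z * (((1 + z) ^ m - 1) / z) := by
        gcongr
    _ = 1 + x * ((1 + z) ^ m - 1) := by field_simp
    _ ≤ x * (1 + z) ^ m := by linarith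
    _ ≤ _ := by gcongr

section Epoch

variable (hP : P.Valid) {n : ℕ} (hn : 0 < n) {κ : ℝ} (hκ : 0 < κ) (hadm : P.Admissible n κ)
  {l : ℝ} (hl : l ∈ Set.Icc P.τmin P.τmax)

include hP hn hκ hadm hl

/-- This is where admissibility enters: with `τ = l/K` and `c` the constant induced by `l`, one has
`L̂ τ K^μ = ν (L̂/(√L̃ L)) c`. The bound is by the full `ν`, twice as strong as positivity of `Δ_k`
requires with its factor `L̂τ/2`. -/
theorem Valid.bracket_le {m : ℕ} (hm : m ≤ P.K n κ) :
    P.Lhat * (l / P.K n κ) * (1 + (1 + 2 / (P.Ltilde * P.β n κ * (l / P.K n κ)))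
      * P.varRate n κ (l / P.K n κ) * (((1 + P.growth n κ (l / P.K n κ)) ^ m - 1)
        / P.growth n κ (l / P.K n κ))) ≤ P.ν := by
  have hK := K_pos (P := P) hn hκ
  have hb := batch_pos (P := P) hn hκ
  have hKr : (0 : ℝ) < P.K n κ := Nat.cast_pos.2 hK
  have hK1 : (1 : ℝ) ≤ P.K n κ := Nat.one_le_cast.2 hK
  have hbr : (0 : ℝ) < P.batch n κ := Nat.cast_pos.2 hb
  have hν := hP.ν_pos
  have hLt := hP.one_le_Ltilde
  have hLh := hP.Lhat_pos
  have hL := hP.L_pos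
  have hl0 : 0 < l := hP.τmin_pos.trans_le hl.1
  have hsc := hP.scale_pos
  have hs : 0 < √P.Ltilde := Real.sqrt_pos.2 (by linarith)
  have hss : √P.Ltilde ^ 2 = P.Ltilde := Real.sq_sqrt (by linarith)
  set K : ℝ := (P.K n κ : ℝ) with hKdef
  set x : ℝ := K ^ P.μ with hx
  have hx1 : 1 ≤ x := Real.one_le_rpow hK1 hP.μ_nonneg
  have hxK : x ≤ K := by
    calc x ≤ K ^ (1 : ℝ) := Real.rpow_le_rpow_of_exponent_le hK1 (by linarith [hP.μ_le])
      _ = K := Real.rpow_one K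
  have hxm : K ^ (P.μ - 1) = x / K := by rw [Real.rpow_sub hKr, Real.rpow_one]
  -- The batch size is at least `K^{2-3μ} = K²/x³`, which turns the variance rate into `c² x / K²`.
  have hbx : K ^ 2 / x ^ 3 ≤ P.batch n κ := by
    have h1 : K ^ (2 - 3 * P.μ) = K ^ 2 / x ^ 3 := by
      rw [Real.rpow_sub hKr, hx, ← Real.rpow_natCast, ← Real.rpow_natCast, ← Real.rpow_mul hKr.le]
      norm_num [mul_comm]
    rw [← h1]
    exact Nat.le_ceil _
  set c : ℝ := l * P.scale * K ^ (P.μ - 1) with hc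
  obtain ⟨⟨hc0, -⟩, hcad⟩ := hadm c ((hP.isInduced_iff n κ c).2 ⟨l, hl, hc⟩)
  have hcx : c = l * P.scale * (x / K) := by rw [hc, hxm]
  have hβτ : P.β n κ * (l / K) = c / K := by
    rw [hcx, β, ← hKdef, hxm, scale]
    ring
  have hx0 : 0 < x := by linarith
  have hq : P.varRate n κ (l / K) ≤ c ^ 2 * x / K ^ 2 := by
    have h1 : P.varRate n κ (l / K) = (l * P.scale) ^ 2 / K ^ 2 / P.batch n κ := by
      rw [varRate, scale]
      nth_rewrite 1 [← hss]
      field_simp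
    have h2 : c ^ 2 * x / K ^ 2 = (l * P.scale) ^ 2 / K ^ 2 / (K ^ 2 / x ^ 3) := by
      rw [hcx]
      field_simp
    rw [h1, h2]
    gcongr
  have hq0 : 0 ≤ P.varRate n κ (l / K) := by
    unfold varRate
    positivity
  have hbr := bracket_le_of hK hx1 hxK hc0 hq0 hq hLt hm
  have hg : P.growth n κ (l / K) = 2 * (c / K) + P.varRate n κ (l / K) := by
    rw [growth, mul_assoc, hβτ]
  rw [hg, mul_assoc P.Ltilde, hβτ]
  calc _ ≤ P.Lhat * (l / K) * (x * Real.exp (c ^ 2 + 2 * c)) := by gcongr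
    _ = P.ν * (P.Lhat / (√P.Ltilde * P.L) * Real.exp (c ^ 2 + 2 * c) * c) := by
        rw [hcx, scale]
        field_simp
    _ ≤ P.ν * 1 := by gcongr
    _ = P.ν := mul_one _

omit hadm in
theorem Valid.β_mul_pos : 0 < P.β n κ * (l / P.K n κ) := by
  have hK : (0 : ℝ) < P.K n κ := Nat.cast_pos.2 (K_pos (P := P) hn hκ)
  have hl0 : 0 < l := hP.τmin_pos.trans_le hl.1
  have hsc := hP.scale_pos
  have : P.β n κ = P.scale * (P.K n κ : ℝ) ^ (P.μ - 1) := rfl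
  rw [this]
  positivity

omit hadm hn hκ hl in
theorem Valid.varRate_nonneg (τ : ℝ) : 0 ≤ P.varRate n κ τ := by
  have := hP.one_le_Ltilde
  unfold varRate
  positivity

omit hadm in
theorem Valid.growth_pos : 0 < P.growth n κ (l / P.K n κ) := by
  have h1 := hP.β_mul_pos hn hκ hl
  have h2 := hP.varRate_nonneg (n := n) (κ := κ) (l / P.K n κ)
  unfold growth
  linarith

theorem Valid.Delta_mem {k : ℕ} (hk : k < P.K n κ) :
    P.Delta n κ (l / P.K n κ) k
      ∈ Set.Icc (l / P.K n κ * P.ν / 2) (l / P.K n κ * P.ν) := by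
  have hKr : (0 : ℝ) < P.K n κ := Nat.cast_pos.2 (K_pos (P := P) hn hκ)
  have hl0 : 0 < l := hP.τmin_pos.trans_le hl.1
  have hτ : 0 < l / P.K n κ := by positivity
  have hLh := hP.Lhat_pos
  have h1 := hP.bracket_le hn hκ hadm hl (m := P.K n κ - k - 1) (by omega)
  have hz := hP.growth_pos hn hκ hl
  have hq := hP.varRate_nonneg (n := n) (κ := κ) (l / P.K n κ)
  have hβ := hP.β_mul_pos hn hκ hl
  have hLt := hP.one_le_Ltilde
  have h1pow : 1 ≤ (1 + P.growth n κ (l / P.K n κ)) ^ (P.K n κ - k - 1) :=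
    one_le_pow₀ (by linarith)
  set Br := 1 + (1 + 2 / (P.Ltilde * P.β n κ * (l / P.K n κ)))
      * P.varRate n κ (l / P.K n κ) * (((1 + P.growth n κ (l / P.K n κ)) ^ (P.K n κ - k - 1) - 1)
        / P.growth n κ (l / P.K n κ)) with hBr
  have hBr0 : 0 ≤ Br := by
    have h2 : 0 ≤ ((1 + P.growth n κ (l / P.K n κ)) ^ (P.K n κ - k - 1) - 1)
        / P.growth n κ (l / P.K n κ) := div_nonneg (by linarith) hz.le
    have h3 : 0 < P.Ltilde * P.β n κ * (l / P.K n κ) := by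
      rw [mul_assoc]
      positivity
    positivity
  have hD : P.Delta n κ (l / P.K n κ) k
      = l / P.K n κ * (P.ν - P.Lhat * (l / P.K n κ) / 2 * Br) := rfl
  rw [hD]
  constructor
  · nlinarith
  · refine mul_le_mul_of_nonneg_left ?_ hτ.le
    have : 0 ≤ P.Lhat * (l / P.K n κ) / 2 * Br := by positivity
    linarith

theorem Valid.sum_Delta_ge :
    P.K n κ * (l / P.K n κ * P.ν / 2)
      ≤ ∑ j ∈ Finset.range (P.K n κ), P.Delta n κ (l / P.K n κ) j := by
  have := Finset.card_nsmul_le_sum (Finset.range (P.K n κ)) (P.Delta n κ (l / P.K n κ)) _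
    fun j hj => (hP.Delta_mem hn hκ hadm hl (Finset.mem_range.1 hj)).1
  simpa using this

theorem Valid.sum_Delta_pos :
    0 < ∑ j ∈ Finset.range (P.K n κ), P.Delta n κ (l / P.K n κ) j := by
  have hKr : (0 : ℝ) < P.K n κ := Nat.cast_pos.2 (K_pos (P := P) hn hκ)
  have hl0 : 0 < l := hP.τmin_pos.trans_le hl.1
  have hν := hP.ν_pos
  exact lt_of_lt_of_le (by positivity) (hP.sum_Delta_ge hn hκ hadm hl)

theorem Valid.prob_nonneg (k : ℕ) : 0 ≤ P.prob n κ (l / P.K n κ) k := by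
  unfold prob
  split_ifs with hk
  · refine div_nonneg (le_trans ?_ (hP.Delta_mem hn hκ hadm hl hk).1)
      (hP.sum_Delta_pos hn hκ hadm hl).le
    have hl0 : 0 < l := hP.τmin_pos.trans_le hl.1
    have hν := hP.ν_pos
    positivity
  · exact le_rfl

theorem Valid.sum_prob :
    ∑ k ∈ Finset.range (P.K n κ + 1), P.prob n κ (l / P.K n κ) k = 1 := by
  rw [Finset.sum_range_succ]
  have h1 : P.prob n κ (l / P.K n κ) (P.K n κ) = 0 := by simp [prob]
  have h2 : ∀ k ∈ Finset.range (P.K n κ), P.prob n κ (l / P.K n κ) k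
      = P.Delta n κ (l / P.K n κ) k
        / ∑ j ∈ Finset.range (P.K n κ), P.Delta n κ (l / P.K n κ) j := fun k hk => by
    rw [prob, if_pos (Finset.mem_range.1 hk)]
  rw [h1, add_zero, Finset.sum_congr rfl h2, ← Finset.sum_div,
    div_self (hP.sum_Delta_pos hn hκ hadm hl).ne']

/-- All `Δ_k` agree up to a factor two, so the selection is at most twice the uniform one on `k <
K`. -/
theorem Valid.prob_le {k : ℕ} (hk : k < P.K n κ) :
    P.prob n κ (l / P.K n κ) k ≤ 2 / P.K n κ := by
  have hKr : (0 : ℝ) < P.K n κ := Nat.cast_pos.2 (K_pos (P := P) hn hκ)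
  have hl0 : 0 < l := hP.τmin_pos.trans_le hl.1
  have hν := hP.ν_pos
  rw [prob, if_pos hk, div_le_div_iff₀ (hP.sum_Delta_pos hn hκ hadm hl) hKr]
  have h1 := (hP.Delta_mem hn hκ hadm hl hk).2
  have h2 := hP.sum_Delta_ge hn hκ hadm hl
  have h3 := mul_le_mul_of_nonneg_right h1 hKr.le
  linarith

/-- The factor `L₂ C + L₁² L` of the quadratic term in the descent inequality. -/
noncomputable def quad (P : Consts) : ℝ := P.L₂ * P.C + P.L₁ ^ 2 * P.L

/-- The weight of the squared anchor distance in the Lyapunov function with `m` iterations to go. -/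
noncomputable def weight (P : Consts) (n : ℕ) (κ τ : ℝ) (m : ℕ) : ℝ :=
  P.quad * τ ^ 2 * (P.L ^ 2 / (P.ν ^ 2 * P.batch n κ))
    * (((1 + P.growth n κ τ) ^ m - 1) / P.growth n κ τ)

/-- The fraction of the step that survives as guaranteed decrease. -/
noncomputable def decrease (P : Consts) : ℝ := P.L₂ * P.C / P.Lhat

omit hadm hn hκ hl in
theorem Valid.quad_nonneg : 0 ≤ P.quad := by
  have := hP.L₂_pos
  have := hP.C_pos
  have := hP.L_pos
  unfold quad
  positivity

omit hadm in
theorem Valid.weight_nonneg (m : ℕ) : 0 ≤ P.weight n κ (l / P.K n κ) m := by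
  have hz := hP.growth_pos hn hκ hl
  have h1 : 1 ≤ (1 + P.growth n κ (l / P.K n κ)) ^ m := one_le_pow₀ (by linarith)
  have h2 := hP.quad_nonneg
  have h3 : 0 ≤ ((1 + P.growth n κ (l / P.K n κ)) ^ m - 1) / P.growth n κ (l / P.K n κ) :=
    div_nonneg (by linarith) hz.le
  unfold weight
  positivity

omit hadm in
-- Backward recursion of the Lyapunov weights: one iteration inflates the squared anchor distance by
-- `1 + growth`, and the variance in the descent inequality adds the constant term.
theorem Valid.weight_succ (m : ℕ) :
    P.weight n κ (l / P.K n κ) (m + 1)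
      = P.weight n κ (l / P.K n κ) m * (1 + P.growth n κ (l / P.K n κ))
        + P.quad * (l / P.K n κ) ^ 2 * (P.L ^ 2 / (P.ν ^ 2 * P.batch n κ)) := by
  have hz := (hP.growth_pos hn hκ hl).ne'
  unfold weight
  field_simp
  ring

/-- The right side is the coefficient of `‖grad f‖²` left in a Lyapunov step. Factoring `quad τ²`
out of the subtracted terms leaves the bracket of `Δ_k` with `1/(2L̃βτ)` in place of `2/(L̃βτ)`.
Hence they total at most `(quad/L̂) τν`. -/
theorem Valid.decrease_le {m : ℕ} (hm : m ≤ P.K n κ) :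
    P.decrease * (l / P.K n κ) * P.ν ≤ (l / P.K n κ) * P.ν - P.quad * (l / P.K n κ) ^ 2
      - P.weight n κ (l / P.K n κ) m
        * (P.Ltilde * (l / P.K n κ) ^ 2 + l / P.K n κ / (2 * P.β n κ)) := by
  have hKr : (0 : ℝ) < P.K n κ := Nat.cast_pos.2 (K_pos (P := P) hn hκ)
  have hbr : (0 : ℝ) < P.batch n κ := Nat.cast_pos.2 (batch_pos (P := P) hn hκ)
  have hl0 : 0 < l := hP.τmin_pos.trans_le hl.1
  have h1 := hP.bracket_le hn hκ hadm hl hm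
  have hz := hP.growth_pos hn hκ hl
  have hq := hP.varRate_nonneg (n := n) (κ := κ) (l / P.K n κ)
  have hβ := hP.β_mul_pos hn hκ hl
  have hLt := hP.one_le_Ltilde
  have hLh := hP.Lhat_pos
  have hν := hP.ν_pos
  have hqd := hP.quad_nonneg
  set τ := l / P.K n κ with hτdef
  have hτ : 0 < τ := by positivity
  have hβ0 : 0 < P.β n κ := pos_of_mul_pos_left hβ hτ.le
  have h1pow : 1 ≤ (1 + P.growth n κ τ) ^ m := one_le_pow₀ (by linarith)
  set G := ((1 + P.growth n κ τ) ^ m - 1) / P.growth n κ τ with hG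
  have hG0 : 0 ≤ G := div_nonneg (by linarith) hz.le
  have e1 : P.quad * τ ^ 2 + P.weight n κ τ m * (P.Ltilde * τ ^ 2 + τ / (2 * P.β n κ))
      = P.quad * τ ^ 2 * (1 + (1 + 1 / (2 * (P.Ltilde * P.β n κ * τ))) * P.varRate n κ τ * G) := by
    rw [weight, ← hG, varRate]
    field_simp
  have e2 : (1 + (1 + 1 / (2 * (P.Ltilde * P.β n κ * τ))) * P.varRate n κ τ * G)
      ≤ 1 + (1 + 2 / (P.Ltilde * P.β n κ * τ)) * P.varRate n κ τ * G := by
    have h2 : 1 / (2 * (P.Ltilde * P.β n κ * τ)) ≤ 2 / (P.Ltilde * P.β n κ * τ) := by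
      have h3 : 0 < P.Ltilde * P.β n κ * τ := by positivity
      rw [div_le_div_iff₀ (by positivity) h3]
      linarith
    gcongr
  have e3 : P.quad * τ ^ 2 * (1 + (1 + 2 / (P.Ltilde * P.β n κ * τ)) * P.varRate n κ τ * G)
      ≤ P.quad / P.Lhat * τ * P.ν := by
    have := mul_le_mul_of_nonneg_left h1 (show 0 ≤ P.quad / P.Lhat * τ by positivity)
    refine le_of_eq_of_le ?_ this
    field_simp
  have e4 : P.decrease * τ * P.ν = τ * P.ν - P.quad / P.Lhat * τ * P.ν := by
    have : P.decrease = 1 - P.quad / P.Lhat := by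
      rw [decrease, quad, eq_sub_iff_add_eq, ← add_div, div_eq_one_iff_eq hLh.ne', Lhat]
      ring
    rw [this]
    ring
  have e5 := mul_le_mul_of_nonneg_left e2 (show 0 ≤ P.quad * τ ^ 2 by positivity)
  linarith

end Epoch

end Consts

/-! ### Expected effect of one inner iteration. -/

section Inner

variable {d n : ℕ} {P : Consts} {I : Input d P.r n} {D : ℝ}

theorem Input.Valid.smooth (hn : 0 < n) (hI : I.Valid P D) :
    SmoothOnStiefel (avgFun I.f) P.L where
  differentiableAt X hX := differentiableAt_avgFun fun i => hI.differentiable i X hX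
  lipschitz X hX Y hY := by
    have hn' : (0 : ℝ) < n := Nat.cast_pos.2 hn
    rw [euclGrad_avgFun fun i => hI.differentiable i X hX,
      euclGrad_avgFun fun i => hI.differentiable i Y hY, ← smul_sub, ← Finset.sum_sub_distrib,
      norm_smul, Real.norm_of_nonneg (by positivity)]
    have h : ‖∑ i, (euclGrad (I.f i) X - euclGrad (I.f i) Y)‖ ≤ n * (P.L * ‖X - Y‖) := by
      refine (norm_sum_le_of_le _ fun i _ => hI.lipschitz i X hX Y hY).trans_eq ?_
      simp
    calc 1 / (n : ℝ) * _ ≤ 1 / (n : ℝ) * (n * (P.L * ‖X - Y‖)) := by gcongr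
      _ = _ := by field_simp

/-- The error of the stochastic gradient. -/
noncomputable def stochError (P : Consts) (I : Input d P.r n) (σ : State d P.r)
    (B : Fin (P.batch n I.κ) → Fin n) : Matrix (Fin d) (Fin P.r) ℝ :=
  (1 / (P.batch n I.κ : ℝ)) • ∑ j, (euclGrad (I.f (B j)) σ.x - euclGrad (I.f (B j)) σ.anchor)
    - (1 / (n : ℝ)) • ∑ i, (euclGrad (I.f i) σ.x - euclGrad (I.f i) σ.anchor)

theorem stochGrad_eq (hI : I.Valid P D) {σ : State d P.r} (hx : σ.x ∈ stiefel d P.r)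
    (ha : σ.anchor ∈ stiefel d P.r) (B : Fin (P.batch n I.κ) → Fin n) :
    stochGrad P I σ B = euclGrad (avgFun I.f) σ.x + stochError P I σ B := by
  rw [stochGrad, stochError, Finset.sum_sub_distrib (fun i => euclGrad (I.f i) σ.x),
    smul_sub _ (∑ i, euclGrad (I.f i) σ.x),
    ← euclGrad_avgFun fun i => hI.differentiable i _ hx,
    ← euclGrad_avgFun fun i => hI.differentiable i _ ha]
  abel

theorem sum_stochError (hn : 0 < n) (hI : I.Valid P D) (σ : State d P.r) :
    ∑ B, stochError P I σ B = 0 := by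
  have : Nonempty (Fin n) := ⟨⟨0, hn⟩⟩
  have h := sum_sampling_error
    (fun i : Fin n => euclGrad (I.f i) σ.x - euclGrad (I.f i) σ.anchor)
    (Consts.batch_pos (P := P) hn hI.κ_pos)
  simp only [Fintype.card_fin] at h
  exact h

theorem avg_inn_dirOp_stochGrad (hn : 0 < n) (hI : I.Valid P D) {σ : State d P.r}
    (hx : σ.x ∈ stiefel d P.r) (ha : σ.anchor ∈ stiefel d P.r)
    (W : Matrix (Fin d) (Fin P.r) ℝ) :
    (avg fun B => inn W (dirOp P.ρ σ.x (stochGrad P I σ B)))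
      = inn W (rieGrad P.ρ (avgFun I.f) σ.x) := by
  have : Nonempty (Fin n) := ⟨⟨0, hn⟩⟩
  have h0 : (avg fun B => inn W (dirOp P.ρ σ.x (stochError P I σ B))) = 0 := by
    rw [avg, ← inn_sum_right, ← dirOp_sum, sum_stochError hn hI, dirOp_zero, inn_zero_right,
      zero_div]
  simp only [stochGrad_eq hI hx ha, dirOp_add, inn_add_right, avg_add, avg_const, h0, add_zero]
  rfl

theorem avg_norm_dirOp_stochGrad_sq_le (hP : P.Valid) (hn : 0 < n) (hI : I.Valid P D)
    {σ : State d P.r} (hx : σ.x ∈ stiefel d P.r) (ha : σ.anchor ∈ stiefel d P.r) :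
    (avg fun B => ‖dirOp P.ρ σ.x (stochGrad P I σ B)‖ ^ 2)
      ≤ ‖rieGrad P.ρ (avgFun I.f) σ.x‖ ^ 2
        + P.L ^ 2 / (P.ν ^ 2 * P.batch n I.κ) * ‖σ.x - σ.anchor‖ ^ 2 := by
  have : Nonempty (Fin n) := ⟨⟨0, hn⟩⟩
  have hb := Consts.batch_pos (P := P) hn hI.κ_pos
  have hbr : (0 : ℝ) < P.batch n I.κ := Nat.cast_pos.2 hb
  have hν := hP.ν_pos
  set g := rieGrad P.ρ (avgFun I.f) σ.x with hg
  -- Writing `‖g + e‖² = 2⟨g, g + e⟩ - ‖g‖² + ‖e‖²` makes the middle term average out by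
  -- unbiasedness alone.
  have hpt : ∀ B, ‖dirOp P.ρ σ.x (stochGrad P I σ B)‖ ^ 2
      ≤ (2 * inn g (dirOp P.ρ σ.x (stochGrad P I σ B)) + -‖g‖ ^ 2)
        + 1 / P.ν ^ 2 * ‖stochError P I σ B‖ ^ 2 := by
    intro B
    have e : dirOp P.ρ σ.x (stochGrad P I σ B) = g + dirOp P.ρ σ.x (stochError P I σ B) := by
      rw [stochGrad_eq hI hx ha, dirOp_add]
      rfl
    have h1 := hP.ν_mul_norm_dirOp_le hx (stochError P I σ B)
    have h2 : ‖dirOp P.ρ σ.x (stochError P I σ B)‖ ^ 2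
        ≤ 1 / P.ν ^ 2 * ‖stochError P I σ B‖ ^ 2 := by
      have h3 := pow_le_pow_left₀ (by positivity) h1 2
      rw [div_mul_eq_mul_div, one_mul, le_div_iff₀ (by positivity)]
      linarith
    rw [e, inn_add_right, norm_add_sq_inn, ← norm_sq_eq_inn]
    linarith
  have hvar : (avg fun B => ‖stochError P I σ B‖ ^ 2)
      ≤ 1 / P.batch n I.κ * (P.L ^ 2 * ‖σ.x - σ.anchor‖ ^ 2) := by
    have h1 := avg_norm_sampling_error_sq_le
      (fun i : Fin n => euclGrad (I.f i) σ.x - euclGrad (I.f i) σ.anchor) hb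
    rw [Fintype.card_fin] at h1
    refine h1.trans (mul_le_mul_of_nonneg_left ?_ (by positivity))
    rw [← avg_const (α := Fin n) (P.L ^ 2 * ‖σ.x - σ.anchor‖ ^ 2)]
    refine avg_mono fun i => ?_
    rw [← mul_pow]
    exact pow_le_pow_left₀ (norm_nonneg _) (hI.lipschitz i _ hx _ ha) 2
  refine (avg_mono hpt).trans ?_
  rw [avg_add, avg_add, avg_const_mul, avg_const_mul, avg_const,
    avg_inn_dirOp_stochGrad hn hI hx ha, ← hg, ← norm_sq_eq_inn]
  have := mul_le_mul_of_nonneg_left hvar (show 0 ≤ 1 / P.ν ^ 2 by positivity)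
  have e : 1 / P.ν ^ 2 * (1 / (P.batch n I.κ : ℝ) * (P.L ^ 2 * ‖σ.x - σ.anchor‖ ^ 2))
      = P.L ^ 2 / (P.ν ^ 2 * P.batch n I.κ) * ‖σ.x - σ.anchor‖ ^ 2 := by
    field_simp
  linarith

theorem smul_neg_step_mem_tangent {σ : State d P.r} (hx : σ.x ∈ stiefel d P.r)
    (G : Matrix (Fin d) (Fin P.r) ℝ) (t : ℝ) :
    t • -(σ.step • dirOp P.ρ σ.x G) ∈ tangent P.ρ σ.x := by
  have : t • -(σ.step • dirOp P.ρ σ.x G) = (-(t * σ.step)) • dirOp P.ρ σ.x G := by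
    rw [← neg_smul, smul_smul, mul_neg]
  rw [this]
  exact smul_dirOp_mem_tangent _ _ hx _

theorem innerStep_x_mem (hI : I.Valid P D) {σ : State d P.r} (hx : σ.x ∈ stiefel d P.r)
    (B : Fin (P.batch n I.κ) → Fin n) : (innerStep P I σ B).x ∈ stiefel d P.r := by
  refine hI.retraction.mapsTo _ hx _ ?_
  simpa using smul_neg_step_mem_tangent hx (stochGrad P I σ B) 1

theorem avg_objective_innerStep_le (hP : P.Valid) (hn : 0 < n) (hI : I.Valid P D)
    {σ : State d P.r} (hx : σ.x ∈ stiefel d P.r) (ha : σ.anchor ∈ stiefel d P.r)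
    (hτ : 0 ≤ σ.step) :
    (avg fun B => avgFun I.f (innerStep P I σ B).x)
      ≤ avgFun I.f σ.x - σ.step * P.ν * ‖rieGrad P.ρ (avgFun I.f) σ.x‖ ^ 2
        + P.quad * σ.step ^ 2 * (‖rieGrad P.ρ (avgFun I.f) σ.x‖ ^ 2
          + P.L ^ 2 / (P.ν ^ 2 * P.batch n I.κ) * ‖σ.x - σ.anchor‖ ^ 2) := by
  have : Nonempty (Fin n) := ⟨⟨0, hn⟩⟩
  have hpt : ∀ B, avgFun I.f (innerStep P I σ B).x ≤ (avgFun I.f σ.x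
      + -σ.step * inn (euclGrad (avgFun I.f) σ.x) (dirOp P.ρ σ.x (stochGrad P I σ B)))
      + P.quad * σ.step ^ 2 * ‖dirOp P.ρ σ.x (stochGrad P I σ B)‖ ^ 2 := by
    intro B
    have := (hI.smooth hn).retraction_le hP.L_pos.le hI.retraction hI.constants hx
      (hI.grad_bound _ hx) (smul_neg_step_mem_tangent hx (stochGrad P I σ B))
    rw [inn_neg_right, inn_smul_right, norm_neg, norm_smul, mul_pow, Real.norm_eq_abs, sq_abs]
      at this
    change avgFun I.f (I.R _ _) ≤ _
    rw [Consts.quad]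
    linarith
  refine (avg_mono hpt).trans ?_
  rw [avg_add, avg_add, avg_const_mul, avg_const_mul, avg_const,
    avg_inn_dirOp_stochGrad hn hI hx ha]
  have h1 := mul_le_mul_of_nonneg_left (avg_norm_dirOp_stochGrad_sq_le hP hn hI hx ha)
    (mul_nonneg hP.quad_nonneg (sq_nonneg σ.step))
  have h2 := mul_le_mul_of_nonneg_left
    (hP.ν_mul_norm_dirOp_sq_le hx (euclGrad (avgFun I.f) σ.x)) hτ
  change σ.step * (P.ν * ‖rieGrad P.ρ (avgFun I.f) σ.x‖ ^ 2)
    ≤ σ.step * inn _ (rieGrad P.ρ (avgFun I.f) σ.x) at h2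
  linarith

theorem avg_dist_innerStep_le (hP : P.Valid) (hn : 0 < n) (hI : I.Valid P D)
    {σ : State d P.r} (hx : σ.x ∈ stiefel d P.r) (ha : σ.anchor ∈ stiefel d P.r)
    (hτ : 0 ≤ σ.step) (hβ : 0 < P.β n I.κ) :
    (avg fun B => ‖(innerStep P I σ B).x - σ.anchor‖ ^ 2)
      ≤ ‖σ.x - σ.anchor‖ ^ 2 * (1 + P.growth n I.κ σ.step)
        + (P.Ltilde * σ.step ^ 2 + σ.step / (2 * P.β n I.κ))
          * ‖rieGrad P.ρ (avgFun I.f) σ.x‖ ^ 2 := by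
  have : Nonempty (Fin n) := ⟨⟨0, hn⟩⟩
  have hLt := hP.one_le_Ltilde
  have hpt : ∀ B, ‖(innerStep P I σ B).x - σ.anchor‖ ^ 2 ≤ (‖σ.x - σ.anchor‖ ^ 2
      + -(2 * σ.step) * inn (σ.x - σ.anchor) (dirOp P.ρ σ.x (stochGrad P I σ B)))
      + P.Ltilde * σ.step ^ 2 * ‖dirOp P.ρ σ.x (stochGrad P I σ B)‖ ^ 2 := by
    intro B
    have := norm_retraction_sub_sq_le hI.constants hx ha
      (by simpa using smul_neg_step_mem_tangent hx (stochGrad P I σ B) 1)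
    rw [inn_neg_right, inn_smul_right, norm_neg, norm_smul, mul_pow, Real.norm_eq_abs, sq_abs]
      at this
    change ‖I.R _ _ - _‖ ^ 2 ≤ _
    rw [Consts.Ltilde]
    linarith
  refine (avg_mono hpt).trans ?_
  rw [avg_add, avg_add, avg_const_mul, avg_const_mul, avg_const,
    avg_inn_dirOp_stochGrad hn hI hx ha]
  have h1 := mul_le_mul_of_nonneg_left (avg_norm_dirOp_stochGrad_sq_le hP hn hI hx ha)
    (show 0 ≤ P.Ltilde * σ.step ^ 2 by positivity)
  set g := rieGrad P.ρ (avgFun I.f) σ.x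
  set u := ‖σ.x - σ.anchor‖
  have h2 := neg_le_of_abs_le (abs_inn_le (σ.x - σ.anchor) g)
  -- Young's inequality with parameter `2β`: the first part joins the growth rate, the second is
  -- charged to the gradient.
  have h3 : 2 * (u * ‖g‖) ≤ 2 * P.β n I.κ * u ^ 2 + 1 / (2 * P.β n I.κ) * ‖g‖ ^ 2 := by
    have h4 : 0 ≤ 1 / (2 * P.β n I.κ) * (2 * P.β n I.κ * u - ‖g‖) ^ 2 := by positivity
    have h5 : 1 / (2 * P.β n I.κ) * (2 * P.β n I.κ * u - ‖g‖) ^ 2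
        = 2 * P.β n I.κ * u ^ 2 + 1 / (2 * P.β n I.κ) * ‖g‖ ^ 2 - 2 * (u * ‖g‖) := by
      field_simp
      ring
    linarith
  have h6 := mul_le_mul_of_nonneg_left (h3.trans' (by linarith :
    -(2 * inn (σ.x - σ.anchor) g) ≤ 2 * (u * ‖g‖))) hτ
  have e : P.growth n I.κ σ.step = 2 * P.β n I.κ * σ.step
      + P.Ltilde * σ.step ^ 2 * (P.L ^ 2 / (P.ν ^ 2 * P.batch n I.κ)) := by
    rw [Consts.growth, Consts.varRate]
    ring
  rw [e]
  have e2 : σ.step / (2 * P.β n I.κ) = σ.step * (1 / (2 * P.β n I.κ)) := by ring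
  rw [e2]
  linarith

end Inner

/-! ### Telescoping over an epoch and over a run. -/

section Run

variable {d n : ℕ} {P : Consts} {I : Input d P.r n} {D : ℝ}

theorem foldl_induction {α σ : Type*} {step : σ → α → σ} {Inv : σ → Prop}
    (h : ∀ x a, Inv x → Inv (step x a)) (l : List α) {x : σ} (hx : Inv x) :
    Inv (l.foldl step x) := by
  induction l generalizing x with
  | nil => exact hx
  | cons a l ih => exact ih (h x a hx)

theorem beginEpoch_step (hP : P.Valid) (hI : I.Valid P D) (σ : State d P.r) :
    ∃ l ∈ Set.Icc P.τmin P.τmax, (beginEpoch P I σ).step = l / P.K n I.κ := by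
  refine ⟨_, ?_, rfl⟩
  split_ifs
  · exact hI.first_step
  · unfold lbb
    simp only
    split_ifs
    · exact ⟨hP.τmin_lt.le, le_rfl⟩
    · exact ⟨le_max_left _ _, max_le hP.τmin_lt.le (min_le_right _ _)⟩

theorem runEpoch_x_mem (hI : I.Valid P D) {σ : State d P.r} (hx : σ.x ∈ stiefel d P.r)
    (Bs : Fin (P.K n I.κ) → Fin (P.batch n I.κ) → Fin n) :
    (runEpoch P I σ Bs).x ∈ stiefel d P.r :=
  foldl_induction (Inv := fun σ : State d P.r => σ.x ∈ stiefel d P.r)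
    (fun _ B h => innerStep_x_mem hI h B) _ hx

/-- The selection-weighted squared gradient norm of an epoch. -/
noncomputable def epochGrad (P : Consts) (I : Input d P.r n) (σ : State d P.r)
    (Bs : Fin (P.K n I.κ) → Fin (P.batch n I.κ) → Fin n) : ℝ :=
  ∑ k ∈ Finset.range (P.K n I.κ + 1), P.prob n I.κ (beginEpoch P I σ).step k
    * ‖rieGrad P.ρ (avgFun I.f)
        (((List.ofFn Bs).take k).foldl (innerStep P I) (beginEpoch P I σ)).x‖ ^ 2

/-- The decrease of the objective in an epoch per unit of selection-weighted squared gradient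
norm. -/
noncomputable def Consts.gain (P : Consts) : ℝ := P.decrease * P.ν * P.τmin / 2

theorem Consts.Valid.decrease_pos (hP : P.Valid) : 0 < P.decrease := by
  have h1 := hP.Lhat_pos
  have h2 := hP.L₂_pos
  have h3 := hP.C_pos
  unfold Consts.decrease
  positivity

theorem Consts.Valid.gain_pos (hP : P.Valid) : 0 < P.gain := by
  have h1 := hP.decrease_pos
  have h2 := hP.ν_pos
  have h3 := hP.τmin_pos
  unfold Consts.gain
  positivity

/-- At the start of the epoch the iterate is the anchor, and at the end the weight is zero, so the
potential equals the objective at both ends. -/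
theorem avg_epoch_le (hP : P.Valid) (hn : 0 < n) (hI : I.Valid P D) {σ : State d P.r}
    (hx : σ.x ∈ stiefel d P.r) :
    (avg fun Bs => avgFun I.f (runEpoch P I σ Bs).x + P.gain * epochGrad P I σ Bs)
      ≤ avgFun I.f σ.x := by
  have : Nonempty (Fin n) := ⟨⟨0, hn⟩⟩
  have hκ := hI.κ_pos
  have hadm := hI.admissible
  have hKr : (0 : ℝ) < P.K n I.κ := Nat.cast_pos.2 (Consts.K_pos (P := P) hn hκ)
  obtain ⟨l, hl, hstep⟩ := beginEpoch_step hP hI σ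
  have hl0 : 0 < l := hP.τmin_pos.trans_le hl.1
  set τ := l / P.K n I.κ with hτdef
  have hτ : 0 < τ := by positivity
  have hβ : 0 < P.β n I.κ := pos_of_mul_pos_left (hP.β_mul_pos hn hκ hl) hτ.le
  have hδ := hP.decrease_pos
  have hν := hP.ν_pos
  have main := avg_foldl_le (innerStep P I)
    (fun y : State d P.r => y.x ∈ stiefel d P.r ∧ y.anchor ∈ stiefel d P.r ∧ y.step = τ)
    (fun y B h => ⟨innerStep_x_mem hI h.1 B, h.2.1, h.2.2⟩) (P.K n I.κ)
    (fun k y => avgFun I.f y.x + P.weight n I.κ τ (P.K n I.κ - k) * ‖y.x - y.anchor‖ ^ 2)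
    (fun _ y _ => P.decrease * τ * P.ν * ‖rieGrad P.ρ (avgFun I.f) y.x‖ ^ 2)
    (by
      rintro k hk y ⟨hyx, hya, hys⟩
      have h1 := avg_objective_innerStep_le hP hn hI hyx hya (hys ▸ hτ.le)
      have h2 := avg_dist_innerStep_le hP hn hI hyx hya (hys ▸ hτ.le) hβ
      have hw := hP.weight_nonneg hn hκ hl (P.K n I.κ - (k + 1))
      have h3 := mul_le_mul_of_nonneg_left h2 hw
      have h4 := hP.weight_succ hn hκ hl (P.K n I.κ - (k + 1))
      have h5 := mul_le_mul_of_nonneg_right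
        (hP.decrease_le hn hκ hadm hl (m := P.K n I.κ - (k + 1)) (by omega))
        (sq_nonneg ‖rieGrad P.ρ (avgFun I.f) y.x‖)
      rw [show P.K n I.κ - (k + 1) + 1 = P.K n I.κ - k by omega] at h4
      rw [avg_add, avg_add, avg_const_mul, avg_const, h4]
      change (avg fun B => avgFun I.f (innerStep P I y B).x) + P.weight n I.κ τ _
        * (avg fun B => ‖(innerStep P I y B).x - y.anchor‖ ^ 2) + _ ≤ _
      rw [hys] at h1 h3
      rw [← hτdef] at h3 h5 ⊢
      linarith)
    (beginEpoch P I σ) ⟨hx, hx, hstep⟩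
  have e0 : (beginEpoch P I σ).x = (beginEpoch P I σ).anchor := rfl
  rw [e0, sub_self, norm_zero] at main
  have e1 : (beginEpoch P I σ).anchor = σ.x := rfl
  rw [e1] at main
  refine le_trans (avg_mono fun Bs => ?_) (main.trans_eq (by ring))
  have hw0 : P.weight n I.κ τ (P.K n I.κ - P.K n I.κ) = 0 := by simp [Consts.weight]
  rw [hw0, zero_mul, add_zero]
  change avgFun I.f (runEpoch P I σ Bs).x + _ ≤ avgFun I.f (runEpoch P I σ Bs).x + _
  refine add_le_add_right ?_ _
  rw [epochGrad, Finset.sum_range_succ, hstep]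
  have hlast : P.prob n I.κ τ (P.K n I.κ) = 0 := by simp [Consts.prob]
  rw [hlast, zero_mul, add_zero, Finset.mul_sum, ← Fin.sum_univ_eq_sum_range
    (fun k => P.gain * (P.prob n I.κ τ k * ‖rieGrad P.ρ (avgFun I.f)
        (((List.ofFn Bs).take k).foldl (innerStep P I) (beginEpoch P I σ)).x‖ ^ 2))]
  refine Finset.sum_le_sum fun k _ => ?_
  rw [← mul_assoc]
  refine mul_le_mul_of_nonneg_right ?_ (sq_nonneg _)
  have h1 := hP.prob_le hn hκ hadm hl k.2
  -- The factor `1/2` in `gain` cancels the `2` of `p_k ≤ 2/K`, and `τmin` makes the gain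
  -- independent of the random step size.
  calc P.gain * P.prob n I.κ τ k ≤ P.gain * (2 / P.K n I.κ) :=
        mul_le_mul_of_nonneg_left h1 hP.gain_pos.le
    _ = P.decrease * (P.τmin / P.K n I.κ) * P.ν := by
        rw [Consts.gain]
        ring
    _ ≤ P.decrease * τ * P.ν := by
        rw [hτdef]
        have := hl.1
        gcongr

theorem selectProb_eq {S : ℕ} (w : Sample P n I.κ S) (s : Fin S) (k : ℕ) :
    selectProb P I w s k = P.prob n I.κ
      (beginEpoch P I (((List.ofFn w).take s).foldl (runEpoch P I) (start P I))).step k := by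
  simp [selectProb, stateAt]

theorem selectProb_isProbability (hP : P.Valid) (hn : 0 < n) (hI : I.Valid P D) {S : ℕ}
    (w : Sample P n I.κ S) (s : Fin S) :
    (∀ k, 0 ≤ selectProb P I w s k) ∧
      ∑ k ∈ Finset.range (P.K n I.κ + 1), selectProb P I w s k = 1 := by
  simp only [selectProb_eq]
  obtain ⟨l, hl, hstep⟩ := beginEpoch_step hP hI
    (((List.ofFn w).take s).foldl (runEpoch P I) (start P I))
  rw [hstep]
  exact ⟨hP.prob_nonneg hn hI.κ_pos hI.admissible hl, hP.sum_prob hn hI.κ_pos hI.admissible hl⟩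

theorem expSqGrad_le (hP : P.Valid) (hn : 0 < n) (hI : I.Valid P D) {S : ℕ} (hS : 0 < S) :
    expSqGrad P I S ≤ D / (P.gain * S) := by
  have : Nonempty (Fin n) := ⟨⟨0, hn⟩⟩
  have hSr : (0 : ℝ) < S := Nat.cast_pos.2 hS
  have hg := hP.gain_pos
  have main := avg_foldl_le (runEpoch P I) (fun σ : State d P.r => σ.x ∈ stiefel d P.r)
    (fun σ Bs h => runEpoch_x_mem hI h Bs) S (fun _ σ => avgFun I.f σ.x)
    (fun _ σ Bs => P.gain * epochGrad P I σ Bs) (fun _ _ σ h => avg_epoch_le hP hn hI h)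
    (start P I) hI.start_mem
  have e : expSqGrad P I S = 1 / (P.gain * S) * avg fun w : Sample P n I.κ S =>
      ∑ s : Fin S, P.gain
        * epochGrad P I (((List.ofFn w).take s).foldl (runEpoch P I) (start P I)) (w s) := by
    rw [← avg_const_mul]
    unfold expSqGrad avg
    congr 1
    refine Finset.sum_congr rfl fun w _ => ?_
    beta_reduce
    rw [← Finset.mul_sum, ← mul_assoc, div_eq_inv_mul]
    congr 1
    field_simp
  rw [avg_add] at main
  have hfin : avgFun I.f I.X₀ - D
      ≤ avg fun w : Sample P n I.κ S => avgFun I.f ((List.ofFn w).foldl (runEpoch P I)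
        (start P I)).x := by
    rw [← avg_const (α := Sample P n I.κ S) (avgFun I.f I.X₀ - D)]
    refine avg_mono fun w => ?_
    have := hI.gap _ (foldl_induction (Inv := fun σ : State d P.r => σ.x ∈ stiefel d P.r)
      (fun σ Bs h => runEpoch_x_mem hI h Bs) (List.ofFn w) (x := start P I) hI.start_mem)
    linarith
  have hst : avgFun I.f (start P I).x = avgFun I.f I.X₀ := rfl
  rw [hst] at main
  rw [e, div_eq_mul_one_div D, mul_comm D]
  exact mul_le_mul_of_nonneg_left (by linarith) (by positivity)

theorem foldl_innerStep_counts (l : List (Fin (P.batch n I.κ) → Fin n)) (σ : State d P.r) :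
    (l.foldl (innerStep P I) σ).ifo = σ.ifo + l.length * (2 * P.batch n I.κ) ∧
      (l.foldl (innerStep P I) σ).ro = σ.ro + l.length := by
  induction l generalizing σ with
  | nil => simp
  | cons B l ih =>
    obtain ⟨h1, h2⟩ := ih (innerStep P I σ B)
    rw [List.foldl_cons, h1, h2, List.length_cons]
    simp only [innerStep]
    constructor <;> ring

theorem foldl_runEpoch_counts (l : List (Fin (P.K n I.κ) → Fin (P.batch n I.κ) → Fin n))
    (σ : State d P.r) :
    (l.foldl (runEpoch P I) σ).ifo
        = σ.ifo + l.length * (n + P.K n I.κ * (2 * P.batch n I.κ)) ∧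
      (l.foldl (runEpoch P I) σ).ro = σ.ro + l.length * P.K n I.κ := by
  induction l generalizing σ with
  | nil => simp
  | cons Bs l ih =>
    obtain ⟨h1, h2⟩ := ih (runEpoch P I σ Bs)
    obtain ⟨h3, h4⟩ := foldl_innerStep_counts (List.ofFn Bs) (beginEpoch P I σ)
    rw [List.length_ofFn] at h3 h4
    have h5 : (runEpoch P I σ Bs).ifo = σ.ifo + n + P.K n I.κ * (2 * P.batch n I.κ) := h3
    have h6 : (runEpoch P I σ Bs).ro = σ.ro + P.K n I.κ := h4
    rw [List.foldl_cons, h1, h2, List.length_cons, h5, h6]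
    constructor <;> ring

theorem finalState_counts {S : ℕ} (w : Sample P n I.κ S) :
    (finalState P I w).ifo = S * (n + P.K n I.κ * (2 * P.batch n I.κ)) ∧
      (finalState P I w).ro = S * P.K n I.κ := by
  obtain ⟨h1, h2⟩ := foldl_runEpoch_counts (I := I) (List.ofFn w) (start P I)
  rw [List.length_ofFn] at h1 h2
  unfold finalState
  rw [h1, h2]
  simp [start]

end Run

/-! ### Complexity bounds and existence of admissible parameters. -/

namespace Consts

variable {P : Consts}

/-- Up to rounding, `K b = K^{3(1-μ)} = κ n`. Rounding `b` costs a factor `2`, and rounding `K`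
costs `2^{3(1-μ)} ≤ 8`. -/
theorem Valid.K_mul_batch_le (hP : P.Valid) {n : ℕ} (hn : 0 < n) {κ : ℝ} (hκ : 0 < κ) :
    (P.K n κ : ℝ) * P.batch n κ ≤ 16 * (n * (1 + κ)) := by
  have hμ0 := hP.μ_nonneg
  have hμ1 := hP.μ_le
  have hK : (1 : ℝ) ≤ P.K n κ := Nat.one_le_cast.2 (K_pos hn hκ)
  have hn1 : (1 : ℝ) ≤ n := Nat.one_le_cast.2 hn
  have hb : (P.batch n κ : ℝ) ≤ 2 * (P.K n κ : ℝ) ^ (2 - 3 * P.μ) := by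
    have h1 := (Nat.ceil_lt_add_one (a := (P.K n κ : ℝ) ^ (2 - 3 * P.μ)) (by positivity)).le
    have h2 : 1 ≤ (P.K n κ : ℝ) ^ (2 - 3 * P.μ) := Real.one_le_rpow hK (by linarith)
    unfold batch
    linarith
  set p := 3 * (1 - P.μ) with hp
  have hp1 : 1 ≤ p := by linarith
  have hp0 : 0 < p := by linarith
  have hKp : (P.K n κ : ℝ) * (P.K n κ : ℝ) ^ (2 - 3 * P.μ) = (P.K n κ : ℝ) ^ p := by
    rw [← Real.rpow_one_add' (by linarith) (by linarith)]
    congr 1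
    ring
  have hx0 : 0 < κ * n := by positivity
  have hKle : (P.K n κ : ℝ) ^ p ≤ 8 * (1 + κ * n) := by
    have h0 : P.K n κ = ⌈(κ * n) ^ (1 / p)⌉₊ := rfl
    -- For `κ n ≤ 1` the ceiling is `1` and no factor-two bound by `(κ n)^{1/p}` is available. This
    -- case accounts for the summand `1`.
    rcases le_total (κ * n) 1 with hx | hx
    · have h1 : (P.K n κ : ℝ) = 1 := by
        refine le_antisymm ?_ hK
        rw [h0, Nat.cast_le_one, Nat.ceil_le, Nat.cast_one]
        exact Real.rpow_le_one hx0.le hx (by positivity)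
      rw [h1, Real.one_rpow]
      linarith
    · have h1 : 1 ≤ (κ * n) ^ (1 / p) := Real.one_le_rpow hx (by positivity)
      have h2 : (P.K n κ : ℝ) ≤ 2 * (κ * n) ^ (1 / p) := by
        have := (Nat.ceil_lt_add_one (a := (κ * n) ^ (1 / p)) (by positivity)).le
        rw [h0]
        linarith
      calc (P.K n κ : ℝ) ^ p ≤ (2 * (κ * n) ^ (1 / p)) ^ p :=
            Real.rpow_le_rpow (by linarith) h2 hp0.le
        _ = 2 ^ p * (κ * n) := by
            rw [Real.mul_rpow (by norm_num) (by positivity), ← Real.rpow_mul hx0.le,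
              one_div_mul_cancel hp0.ne', Real.rpow_one]
        _ ≤ 2 ^ (3 : ℝ) * (κ * n) := by
            gcongr
            · norm_num
            · linarith
        _ ≤ 8 * (1 + κ * n) := by
            norm_num
  calc (P.K n κ : ℝ) * P.batch n κ ≤ P.K n κ * (2 * (P.K n κ : ℝ) ^ (2 - 3 * P.μ)) := by gcongr
    _ = 2 * (P.K n κ : ℝ) ^ p := by rw [← hKp]; ring
    _ ≤ 2 * (8 * (1 + κ * n)) := by gcongr
    _ ≤ 16 * (n * (1 + κ)) := by nlinarith

theorem Valid.K_le_of_isInduced (hP : P.Valid) {n : ℕ} (hn : 0 < n) {κ : ℝ} (hκ : 0 < κ)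
    {c : ℝ} (hc0 : 0 < c) (hc : P.IsInduced n κ c) :
    (P.K n κ : ℝ) ≤ (P.τmax * P.scale / c) ^ (1 / (1 - P.μ)) := by
  have hμ : 0 < 1 - P.μ := by linarith [hP.μ_le]
  have hK : (0 : ℝ) < P.K n κ := Nat.cast_pos.2 (K_pos hn hκ)
  have hsc := hP.scale_pos
  obtain ⟨l, hl, hcl⟩ := (hP.isInduced_iff n κ c).1 hc
  have h1 : (P.K n κ : ℝ) ^ (1 - P.μ) ≤ P.τmax * P.scale / c := by
    rw [le_div_iff₀ hc0, hcl]
    have h2 : (P.K n κ : ℝ) ^ (1 - P.μ) * (P.K n κ : ℝ) ^ (P.μ - 1) = 1 := by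
      rw [← Real.rpow_add hK]
      simp
    calc (P.K n κ : ℝ) ^ (1 - P.μ) * (l * P.scale * (P.K n κ : ℝ) ^ (P.μ - 1))
        = l * P.scale * ((P.K n κ : ℝ) ^ (1 - P.μ) * (P.K n κ : ℝ) ^ (P.μ - 1)) := by ring
      _ = l * P.scale := by rw [h2, mul_one]
      _ ≤ P.τmax * P.scale := mul_le_mul_of_nonneg_right hl.2 hsc.le
  calc (P.K n κ : ℝ) = ((P.K n κ : ℝ) ^ (1 - P.μ)) ^ (1 / (1 - P.μ)) := by
        rw [← Real.rpow_mul hK.le, mul_one_div_cancel hμ.ne', Real.rpow_one]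
    _ ≤ _ := Real.rpow_le_rpow (by positivity) h1 (by positivity)

/-- Fix `N` so large that every constant induced by `K = N` is small enough, and take `κ =
N^{3(1-μ)}/n`. Then `K = N` for every `n`, so the induced constants do not depend on `n`. -/
theorem Valid.exists_admissible (hP : P.Valid) :
    ∃ κ₁ c₀ : ℝ, 0 < κ₁ ∧ 0 < c₀ ∧ ∀ n : ℕ, 0 < n →
      ∃ κ : ℝ, 0 < κ ∧ κ ≤ κ₁ ∧ P.Admissible n κ ∧ ∀ c : ℝ, P.IsInduced n κ c → c₀ ≤ c := by
  have hμ : 0 < 1 - P.μ := by linarith [hP.μ_le]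
  have hsc := hP.scale_pos
  have hτmin := hP.τmin_pos
  have hτmax : 0 < P.τmax := hτmin.trans hP.τmin_lt
  set m := P.Lhat / (√P.Ltilde * P.L) with hm
  have hm0 : 0 ≤ m := by
    have := hP.Lhat_pos
    have := hP.L_pos
    positivity
  have hlim : Filter.Tendsto (fun N : ℕ => P.τmax * P.scale * (N : ℝ) ^ (-(1 - P.μ)))
      Filter.atTop (nhds (P.τmax * P.scale * 0)) :=
    ((tendsto_rpow_neg_atTop hμ).comp tendsto_natCast_atTop_atTop).const_mul _
  rw [mul_zero] at hlim
  -- For `c < 1` the exponent `c² + 2c` is at most `3`, so `c < 1/(m e³ + 1)` implies the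
  -- exponential condition.
  have hη : 0 < min 1 (1 / (m * Real.exp 3 + 1)) := by positivity
  obtain ⟨N, hN, hN0⟩ := ((hlim.eventually_lt_const hη).and (Filter.eventually_gt_atTop 0)).exists
  rw [neg_sub] at hN
  have hNr : (0 : ℝ) < N := Nat.cast_pos.2 hN0
  set p := 3 * (1 - P.μ) with hp
  have hp0 : 0 < p := by positivity
  refine ⟨(N : ℝ) ^ p, P.τmin * P.scale * (N : ℝ) ^ (P.μ - 1), by positivity, by positivity,
    fun n hn => ⟨(N : ℝ) ^ p / n, ?_, ?_, ?_, ?_⟩⟩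
  · positivity
  · exact div_le_self (by positivity) (Nat.one_le_cast.2 hn)
  all_goals
    have hK : P.K n ((N : ℝ) ^ p / n) = N := by
      have hn' : (n : ℝ) ≠ 0 := Nat.cast_ne_zero.2 hn.ne'
      unfold K
      rw [div_mul_cancel₀ _ hn', ← hp, ← Real.rpow_mul hNr.le, mul_one_div_cancel hp0.ne',
        Real.rpow_one, Nat.ceil_natCast]
    intro c hc
    obtain ⟨l, hl, hcl⟩ := (hP.isInduced_iff _ _ c).1 hc
    rw [hK] at hcl
    have hl0 : 0 < l := hτmin.trans_le hl.1
  · have hc0 : 0 < c := by rw [hcl]; positivity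
    have hcle : c < min 1 (1 / (m * Real.exp 3 + 1)) := by
      refine lt_of_le_of_lt ?_ hN
      rw [hcl]
      have := hl.2
      gcongr
    have hc1 : c < 1 := hcle.trans_le (min_le_left _ _)
    have hc2 : c < 1 / (m * Real.exp 3 + 1) := hcle.trans_le (min_le_right _ _)
    refine ⟨⟨hc0, hc1⟩, ?_⟩
    have he : Real.exp (c ^ 2 + 2 * c) ≤ Real.exp 3 := Real.exp_le_exp.2 (by nlinarith)
    rw [lt_div_iff₀ (by positivity)] at hc2
    calc m * Real.exp (c ^ 2 + 2 * c) * c ≤ m * Real.exp 3 * c := by gcongr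
      _ ≤ 1 := by linarith
  · rw [hcl]
    have := hl.1
    gcongr

end Consts

end SVRGBB

theorem mainTheorem7 (P : SVRGBB.Consts) (hP : P.Valid) (D : ℝ) :
    (∃ A B : ℝ → ℝ, MonotoneOn A (Set.Ioi 0) ∧ AntitoneOn B (Set.Ioi 0) ∧
      ∀ (d n : ℕ) (_ : 0 < n) (I : SVRGBB.Input d P.r n) (_ : I.Valid P D)
        (ε : ℝ) (_ : 0 < ε) (_ : ε ≤ 1),
        ∃ S : ℕ, 0 < S ∧
          (∀ (w : SVRGBB.Sample P n I.κ S) (s : Fin S),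
            (∀ k, 0 ≤ SVRGBB.selectProb P I w s k) ∧
            ∑ k ∈ Finset.range (P.K n I.κ + 1), SVRGBB.selectProb P I w s k = 1) ∧
          SVRGBB.expSqGrad P I S ≤ ε ∧
          ∀ w : SVRGBB.Sample P n I.κ S,
            ((SVRGBB.finalState P I w).ifo : ℝ) ≤ A I.κ * n / ε ∧
            ∀ c : ℝ, P.IsInduced n I.κ c →
              ((SVRGBB.finalState P I w).ro : ℝ) ≤ B c / ε) ∧
    (∃ κ₁ c₀ : ℝ, 0 < κ₁ ∧ 0 < c₀ ∧ ∀ n : ℕ, 0 < n →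
      ∃ κ : ℝ, 0 < κ ∧ κ ≤ κ₁ ∧ P.Admissible n κ ∧ ∀ c : ℝ, P.IsInduced n κ c → c₀ ≤ c) := by
  refine ⟨?_, hP.exists_admissible⟩
  have hg := hP.gain_pos
  have hsc := hP.scale_pos
  have hτmax : 0 < P.τmax := hP.τmin_pos.trans hP.τmin_lt
  have hμ : 0 < 1 - P.μ := by linarith [hP.μ_le]
  -- `W` is fixed before any run is given, so `D` may be negative here; the maximum keeps `W`
  -- positive.
  set W : ℝ := max D 0 / P.gain + 2 with hW
  have hW0 : 0 < W := by positivity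
  refine ⟨fun κ => W * (33 + 32 * κ), fun c => W * (P.τmax * P.scale / c) ^ (1 / (1 - P.μ)),
    fun a _ b _ hab => ?_, fun a ha b hb hab => ?_, fun d n hn I hI ε hε hε1 => ?_⟩
  · simp only
    gcongr
  · have ha' : 0 < a := ha
    have hb' : 0 < b := hb
    simp only
    gcongr
  have hnr : (0 : ℝ) < n := Nat.cast_pos.2 hn
  -- The ceiling makes `D/(gain · S) ≤ ε`, and the extra `1` ensures `S > 0`. Rounding costs at most
  -- `2 ≤ 2/ε`, which uses `ε ≤ 1`.
  set S : ℕ := ⌈max D 0 / (P.gain * ε)⌉₊ + 1 with hS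
  have hS0 : 0 < S := Nat.succ_pos _
  have hSr : (0 : ℝ) < S := Nat.cast_pos.2 hS0
  have hSle : (S : ℝ) ≤ W / ε := by
    have h1 := (Nat.ceil_lt_add_one (a := max D 0 / (P.gain * ε)) (by positivity)).le
    have h2 : W / ε = max D 0 / (P.gain * ε) + 2 / ε := by
      rw [hW]
      field_simp
    have h3 : 2 ≤ 2 / ε := by
      rw [le_div_iff₀ hε]
      linarith
    rw [hS, h2]
    push_cast
    linarith
  refine ⟨S, hS0, SVRGBB.selectProb_isProbability hP hn hI, ?_, fun w => ?_⟩
  · refine (SVRGBB.expSqGrad_le hP hn hI hS0).trans ?_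
    rw [div_le_iff₀ (by positivity)]
    have h1 : max D 0 / (P.gain * ε) ≤ S := by
      rw [hS]
      push_cast
      linarith [Nat.le_ceil (max D 0 / (P.gain * ε))]
    rw [div_le_iff₀ (by positivity)] at h1
    linarith [le_max_left D 0]
  · obtain ⟨h1, h2⟩ := SVRGBB.finalState_counts (I := I) w
    rw [h1, h2]
    push_cast
    constructor
    · have h3 := hP.K_mul_batch_le hn hI.κ_pos
      -- An epoch costs `n + 2Kb` gradient calls, and `n + 2 · 16 n (1 + κ) = n (33 + 32κ)`.
      have h4 : (n : ℝ) + P.K n I.κ * (2 * P.batch n I.κ) ≤ n * (33 + 32 * I.κ) := by linarith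
      have hκ := hI.κ_pos
      calc (S : ℝ) * (n + P.K n I.κ * (2 * P.batch n I.κ)) ≤ W / ε * (n * (33 + 32 * I.κ)) := by
            gcongr
        _ = _ := by ring
    · intro c hc
      have h3 := hP.K_le_of_isInduced hn hI.κ_pos (hI.admissible c hc).1.1 hc
      calc (S : ℝ) * P.K n I.κ
          ≤ W / ε * (P.τmax * P.scale / c) ^ (1 / (1 - P.μ)) := by gcongr
        _ = _ := by ring
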